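/- **Setting.** Let $\mathcal G=(V,W)$ be a finite weighted graph: $W_{ij}=W_{ji}\ge 0$, $W_{ii}=0$ ($W_{ij}=0$ means that there is no edge). For $\beta\in\mathbb R^V$ let $H_\beta$ be the matrix with diagonal entries $2\beta_i$ and off-diagonal entries $-W_{ij}$. For $\eta\in\mathbb R_+^V$, the $H^{2|2}$-model on $\mathcal G$ with boundary condition $\eta$ is the random field $\beta$ with the multivariate inverse Gaussian law $$\nu^{W,\eta}(d\beta)=\Big(\tfrac{2}{\pi}\Big)^{|V|/2}\mathbf 1_{\{H_\beta>0\}}\,e^{-\frac12\left(\langle 1,H_\beta 1\rangle+\langle\eta,H_\beta^{-1}\eta\rangle-2\langle 1,\eta\rangle\right)}\frac{1}{\sqrt{\det H_\beta}}\prod_{i\in V}d\beta_i .$$ Let $U\subset V$ be nonempty and indistinguishable from outside, i.e. $W_{ki}=W_{kj}$ for all $i,j\in U$, $k\notin U$. The reduced graph $\mathcal G'$ has vertex set $V'=(V\setminus U)\cup\{u\}$ and weights $W'_{kl}=W_{kl}$ for $k,l\ne u$, $W'_{ku}=W'_{uk}=\sum_{i\in U}W_{ki}$ for $k\neq u$,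 $W'_{uu}=0$. For $b\in\mathbb R^U$ let $H_{U,U}(b)$ be the matrix on $U\times U$ with diagonal $2b_i$ and off-diagonal entries $-W_{ij}$, let $\widehat G^U(b)=H_{U,U}(b)^{-1}$, and define $F(b)$ by $$\frac{1}{2F(b)}=\frac1{|U|^2}\sum_{i,j\in U}\widehat G^U(b)(i,j).$$ **Theorem.** Let $\eta'\in\mathbb R_+^{V'}$, and put $\eta_i=\eta'_i$ for $i\notin U$ and $\eta_i=\frac1{|U|}\eta'_u$ for $i\in U$. Let $\widehat\eta_i=\eta_i+\sum_{k\notin U}W_{ik}$ for $i\in U$, and let $\nu_U=\nu^{W_{U,U},\widehat\eta}$ be the multivariate inverse Gaussian law on $\mathbb R^U$ with weights $(W_{ij})_{i,j\in U}$ and boundary condition $\widehat\eta$. Fix $i_0\in U$. Then $\nu^{W',\eta'}$, $\nu^{W,\eta}$ and $\nu_U$ are probability measures, $\beta'_u>0$ for $\nu^{W',\eta'}$-almost every $\beta'$, and there is a Markov kernel $\kappa$ from $\mathbb R$ to $\mathbb R^U$ such that: 1. For every $t>0$, $\kappa_t$ is concentrated on the level set $\{b: H_{U,U}(b)>0,\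 F(b)=t\}$. On this set $b_{i_0}$ is an explicit function of $a=(b_j)_{j\in U\setminus\{i_0\}}$: with $A$ the block of $H_{U,U}(b)$ on $U\setminus\{i_0\}$ and $w=(W_{i_0j})_{j\in U\setminus\{i_0\}}$, $$2b_{i_0}=\langle w,A^{-1}w\rangle+\frac{(1+\langle w,A^{-1}1\rangle)^2}{\frac{|U|^2}{2t}-\langle 1,A^{-1}1\rangle},$$ and in the coordinates $a$ the law $\kappa_t$ has a density with respect to Lebesgue measure that is proportional to $$\mathbf 1_{\{H_{U,U}(b)>0\}}\;\frac{e^{-\frac12\left(\langle 1,H_{U,U}(b)1\rangle+\langle\widehat\eta,\widehat G^U(b)\widehat\eta\rangle\right)}}{\sqrt{\det H_{U,U}(b)}}\cdot\Big(\frac{\partial F}{\partial b_{i_0}}(b)\Big)^{-1},\qquad \frac{\partial F}{\partial b_{i_0}}(b)=\Big(\frac{2t}{|U|}\sum_{j\in U}\widehat G^U(b)(i_0,j)\Big)^2 .$$ 2. $\kappa$ is the law $\nu_U$ conditioned on the value of $F$: if $b\sim\nu_U$, then $\kappa_{F(b)}$ is a regular conditional law of $b$ given $F(b)$. 3. (Fine-graining.)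 Sample $\beta'$ from the $H^{2|2}$-model on $\mathcal G'$ with boundary condition $\eta'$; given $\beta'$, sample $(\beta_i)_{i\in U}$ from $\kappa_{\beta'_u}$; and put $\beta_k=\beta'_k$ for $k\notin U$. Then $(\beta_i)_{i\in V}$ has the law $\nu^{W,\eta}$ of the $H^{2|2}$-model on $\mathcal G$ with boundary condition $\eta$. 4. Conversely, if $\beta\sim\nu^{W,\eta}$ and $\beta'_k=\beta_k$ for $k\notin U$, $\beta'_u=F((\beta_i)_{i\in U})$, then $\beta'\sim\nu^{W',\eta'}$, and the conditional law of $(\beta_i)_{i\in U}$ given $\beta'$ is $\kappa_{\beta'_u}$. -/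

import Mathlib

open MeasureTheory ProbabilityTheory Matrix

noncomputable section

/-- A finite weighted graph without loops on the vertex set `V`; `weight i j = 0` means that
there is no edge between `i` and `j`. -/
structure WeightedGraph (V : Type*) where
  weight : Matrix V V ℝ
  symm : ∀ i j, weight i j = weight j i
  nonneg : ∀ i j, 0 ≤ weight i j
  loopless : ∀ i, weight i i = 0

namespace WeightedGraph

variable {V : Type*}

/-- The random Schrödinger operator `H_β`: diagonal entries `2 β i`, off-diagonal entries
`- W i j`. -/
def schrodinger [DecidableEq V] (G : WeightedGraph V) (β : V → ℝ) : Matrix V V ℝ :=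
  Matrix.diagonal (fun i => 2 * β i) - G.weight

/-- The Lebesgue density at `β` of the law of the potential with boundary condition `η` (and
initial local time `1`), i.e. of the multivariate inverse Gaussian law. -/
def h22Density [Fintype V] [DecidableEq V] (G : WeightedGraph V) (η : V → ℝ) (β : V → ℝ) : ℝ :=
  Set.indicator {β : V → ℝ | (G.schrodinger β).PosDef}
    (fun β =>
      (√(2 / Real.pi)) ^ Fintype.card V
        * Real.exp (-(1 / 2) *
            ((1 : V → ℝ) ⬝ᵥ (G.schrodinger β *ᵥ 1) + η ⬝ᵥ ((G.schrodinger β)⁻¹ *ᵥ η)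
              - 2 * ((1 : V → ℝ) ⬝ᵥ η)))
        / √(G.schrodinger β).det) β

/-- The law of the potential `β` of the `H^{2|2}`-model on `G` with boundary condition `η`. -/
def h22Law [Fintype V] [DecidableEq V] (G : WeightedGraph V) (η : V → ℝ) : Measure (V → ℝ) :=
  volume.withDensity (fun β => ENNReal.ofReal (G.h22Density η β))

/-- The weighted graph induced on the vertices satisfying `p`. -/
def induce (G : WeightedGraph V) (p : V → Prop) : WeightedGraph {i // p i} where
  weight := fun i j => G.weight i j
  symm := fun i j => G.symm i j
  nonneg := fun i j => G.nonneg i j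
  loopless := fun i => G.loopless i

/-- `U` is indistinguishable from outside: an outer vertex is connected to all vertices of `U`
with the same weight. -/
def Indistinguishable (G : WeightedGraph V) (U : Finset V) : Prop :=
  ∀ i ∈ U, ∀ j ∈ U, ∀ k ∉ U, G.weight k i = G.weight k j

end WeightedGraph

/-- The vertex set `(V \ U) ∪ {u}` of the reduced graph; the new vertex `u` is `none`. -/
abbrev ReducedVertex {V : Type*} (U : Finset V) : Type _ := Option {k : V // k ∉ U}

namespace WeightedGraph

variable {V : Type*}

/-- The weights of the reduced graph. -/
def reducedWeight (G : WeightedGraph V) (U : Finset V) :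
    ReducedVertex U → ReducedVertex U → ℝ
  | none, none => 0
  | none, some k => ∑ i ∈ U, G.weight k i
  | some k, none => ∑ i ∈ U, G.weight k i
  | some k, some l => G.weight k l

/-- The reduced graph, in which `U` is replaced by the single vertex `u`. -/
def reduce (G : WeightedGraph V) (U : Finset V) : WeightedGraph (ReducedVertex U) where
  weight := G.reducedWeight U
  symm := by
    rintro (_ | k) (_ | l)
    · rfl
    · rfl
    · rfl
    · exact G.symm k l
  nonneg := by
    rintro (_ | k) (_ | l)
    · exact le_refl (0 : ℝ)
    · exact Finset.sum_nonneg fun i _ => G.nonneg l i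
    · exact Finset.sum_nonneg fun i _ => G.nonneg k i
    · exact G.nonneg k l
  loopless := by
    rintro (_ | k)
    · rfl
    · exact G.loopless k

/-- The number `b` with `1 / (2 b) = |V|⁻² ∑ i j, (H_β)⁻¹ i j`. Applied to the graph induced on
`U`, it is the potential at the vertex `u` of the reduced graph. -/
def reducedPotential [Fintype V] [DecidableEq V] (G : WeightedGraph V) (β : V → ℝ) : ℝ :=
  (Fintype.card V : ℝ) ^ 2 / (2 * ∑ i, ∑ j, (G.schrodinger β)⁻¹ i j)

/-- The coarse-grained potential: `β' k = β k` for `k ∉ U`, and `β' u` is the reduced potential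
of `(β i)_{i ∈ U}`. -/
def coarsen [DecidableEq V] (G : WeightedGraph V) (U : Finset V) (β : V → ℝ) :
    ReducedVertex U → ℝ
  | none => (G.induce (· ∈ U)).reducedPotential (fun i => β i)
  | some k => β k

/-- The boundary condition that `U` feels, namely `η i + ∑_{k ∉ U} W i k` for `i ∈ U`. -/
def innerBoundary [Fintype V] [DecidableEq V] (G : WeightedGraph V) (U : Finset V) (η : V → ℝ) :
    {i // i ∈ U} → ℝ :=
  fun i => η i + ∑ k ∈ Uᶜ, G.weight i k

/-! Charts of the level set `{β | H_β > 0, reducedPotential β = t}`: for a fixed vertex `i₀` it is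
the graph of the coordinate `β i₀` as a function of the other coordinates `a`. -/

/-- The value of `β i₀` on the level set `t`, given the other coordinates `a`: with `A` the block
of `H_β` on `V \ {i₀}` and `w j = W i₀ j`, it is the `b` with
`2 b = ⟨w, A⁻¹ w⟩ + (1 + ⟨w, A⁻¹ 1⟩)² / (|V|² / (2 t) - ⟨1, A⁻¹ 1⟩)`. -/
def levelCoord [Fintype V] [DecidableEq V] (G : WeightedGraph V) (i₀ : V) (t : ℝ)
    (a : {j // j ≠ i₀} → ℝ) : ℝ :=
  let Ainv := ((G.induce (· ≠ i₀)).schrodinger a)⁻¹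
  let w : {j // j ≠ i₀} → ℝ := fun j => G.weight i₀ j
  (w ⬝ᵥ (Ainv *ᵥ w)
    + (1 + w ⬝ᵥ (Ainv *ᵥ 1)) ^ 2
      / ((Fintype.card V : ℝ) ^ 2 / (2 * t) - (1 : {j // j ≠ i₀} → ℝ) ⬝ᵥ (Ainv *ᵥ 1))) / 2

/-- The point of the level set `t` whose coordinates other than `i₀` are `a`. -/
def levelPoint [Fintype V] [DecidableEq V] (G : WeightedGraph V) (i₀ : V) (t : ℝ)
    (a : {j // j ≠ i₀} → ℝ) : V → ℝ :=
  fun i => if h : i = i₀ then G.levelCoord i₀ t a else a ⟨i, h⟩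

/-- The partial derivative of `reducedPotential` with respect to `β i₀`, at a point `β` of the
level set `t`. -/
def levelJacobian [Fintype V] [DecidableEq V] (G : WeightedGraph V) (i₀ : V) (t : ℝ)
    (β : V → ℝ) : ℝ :=
  (2 * t / Fintype.card V * ∑ j, (G.schrodinger β)⁻¹ i₀ j) ^ 2

/-- The multivariate inverse Gaussian law restricted to the level set `t`, not normalized: in the
chart above it has Lebesgue density `h22Density / levelJacobian`. -/
def levelMeasure [Fintype V] [DecidableEq V] (G : WeightedGraph V) (η : V → ℝ) (i₀ : V) (t : ℝ) :
    Measure (V → ℝ) :=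
  ((volume : Measure ({j // j ≠ i₀} → ℝ)).withDensity (fun a =>
    ENNReal.ofReal (G.h22Density η (G.levelPoint i₀ t a)
      / G.levelJacobian i₀ t (G.levelPoint i₀ t a)))).map (G.levelPoint i₀ t)

/-- The normalization of `levelMeasure` to total mass one. -/
def levelLaw [Fintype V] [DecidableEq V] (G : WeightedGraph V) (η : V → ℝ) (i₀ : V) (t : ℝ) :
    Measure (V → ℝ) :=
  (G.levelMeasure η i₀ t Set.univ)⁻¹ • G.levelMeasure η i₀ t

end WeightedGraph

/-- The boundary condition on the original graph obtained from `η'` by splitting `η' u` equally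
over `U`. -/
def splitBoundary {V : Type*} [DecidableEq V] (U : Finset V) (η' : ReducedVertex U → ℝ) :
    V → ℝ :=
  fun i => if h : i ∈ U then η' none / U.card else η' (some ⟨i, h⟩)

/-- The potential on the original graph that equals `β'` outside `U` and `b` on `U`. -/
def refine {V : Type*} [DecidableEq V] (U : Finset V) (β' : ReducedVertex U → ℝ)
    (b : {i // i ∈ U} → ℝ) : V → ℝ :=
  fun i => if h : i ∈ U then b ⟨i, h⟩ else β' (some ⟨i, h⟩)

end

/-! ### Block elimination and Schur complements. -/

section BlockMatrices

variable {m n : Type*} [Fintype m] [Fintype n] [DecidableEq m] [DecidableEq n]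

/-! The inverse Gaussian density factors along a block decomposition of `H_β`
(`igDensity_fromBlocks`): the density of one block, with the boundary shifted by the weights leaving
it, times the density of the Schur complement with a transported boundary. Peeling off one vertex at
a time reduces the normalization to a one-dimensional integral.

Take `U` as the first block. Indistinguishability makes the cross weights a rank-one matrix `1 ⊗ w`,
so the Schur complement and the transported boundary see the inverse of `H_{U,U}` only through its
total mass, that is, through `F`. The same elimination of `u` in the reduced graph, at potential
`F`, produces the same second factor. Thus, given `F` and the potential outside `U`, the density on
`U` is that of `ν_U` up to a constant (`Indistinguishable.scalarDensity_mul_h22Density`). It remains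
to disintegrate `ν_U` over the level sets of `F` and to find the law of `F`.

The disintegration is a change of variables in the single coordinate at `i₀`, since `⟨1, H⁻¹ 1⟩` is
a constant plus a multiple of the inverse pivot at `i₀` (`dotProduct_inv_mulVec_one`).

The law of `F` comes from the normalization alone. A constant boundary `θ / |U|` multiplies the mass
of the level set `t` by `exp (θ - θ² / (4 t))`, exactly as in the one-vertex model. Total mass one
for all `θ ≥ 0` then gives both masses the same Laplace transform in `1 / t`, so they agree for
almost every `t` (`ae_levelMeasure_zero_univ`). Continuity in `t` extends this to every `t > 0`
(`levelMeasure_univ`), so the normalized level measures form a Markov kernel. -/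

theorem Matrix.PosDef.fromBlocks_iff {A : Matrix m m ℝ} (B : Matrix m n ℝ) (D : Matrix n n ℝ) :
    (fromBlocks A B Bᵀ D).PosDef ↔ A.PosDef ∧ (D - Bᵀ * A⁻¹ * B).PosDef := by
  by_cases hA : A.PosDef
  · have hu : IsUnit A := hA.isUnit
    let _ : Invertible A := hu.invertible
    have hpsd := PosDef.fromBlocks₁₁ B D hA
    have hdet := det_fromBlocks₁₁ A B Bᵀ D
    rw [invOf_eq_nonsing_inv] at hdet
    rw [conjTranspose_eq_transpose_of_trivial] at hpsd
    have hA0 := hA.det_pos.ne'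
    simp only [hA, true_and]
    -- A semidefinite matrix with nonzero determinant is definite, and the determinant is
    -- multiplicative along the Schur complement; this upgrades the semidefinite criterion `hpsd`.
    constructor
    · intro h
      rw [(hpsd.1 h.posSemidef).posDef_iff_isUnit, isUnit_iff_isUnit_det, isUnit_iff_ne_zero]
      exact right_ne_zero_of_mul (hdet ▸ h.det_pos.ne')
    · intro h
      rw [(hpsd.2 h.posSemidef).posDef_iff_isUnit, isUnit_iff_isUnit_det, isUnit_iff_ne_zero, hdet]
      exact mul_ne_zero hA0 h.det_pos.ne'
  · simp only [hA, false_and, iff_false]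
    intro h
    exact hA (h.submatrix (e := (Sum.inl : m → m ⊕ n)) Sum.inl_injective)

/-- Gaussian elimination: the second component solves the Schur system, the first follows by back
substitution. The claimed solution is checked by applying the block matrix to it. -/
theorem Matrix.inv_fromBlocks_mulVec {A : Matrix m m ℝ} (B : Matrix m n ℝ) (C : Matrix n m ℝ)
    (D : Matrix n n ℝ)
    (hA : IsUnit A) (hS : IsUnit (D - C * A⁻¹ * B)) (x : m → ℝ) (y : n → ℝ) :
    (fromBlocks A B C D)⁻¹ *ᵥ Sum.elim x y =
      Sum.elim (A⁻¹ *ᵥ (x - B *ᵥ ((D - C * A⁻¹ * B)⁻¹ *ᵥ (y - C *ᵥ (A⁻¹ *ᵥ x)))))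
        ((D - C * A⁻¹ * B)⁻¹ *ᵥ (y - C *ᵥ (A⁻¹ *ᵥ x))) := by
  set S := D - C * A⁻¹ * B with hSdef
  set z := S⁻¹ *ᵥ (y - C *ᵥ (A⁻¹ *ᵥ x)) with hz
  have hAd := (isUnit_iff_isUnit_det A).1 hA
  have hSd := (isUnit_iff_isUnit_det S).1 hS
  have hM : IsUnit (fromBlocks A B C D).det := by
    let _ : Invertible A := hA.invertible
    rw [det_fromBlocks₁₁, invOf_eq_nonsing_inv]
    exact hAd.mul hSd
  have hSz : D *ᵥ z - C *ᵥ (A⁻¹ *ᵥ (B *ᵥ z)) = y - C *ᵥ (A⁻¹ *ᵥ x) := by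
    have : S *ᵥ z = y - C *ᵥ (A⁻¹ *ᵥ x) := by
      rw [hz, mulVec_mulVec, mul_nonsing_inv _ hSd, one_mulVec]
    rw [← this, hSdef, sub_mulVec, ← mulVec_mulVec, ← mulVec_mulVec]
  have key : fromBlocks A B C D *ᵥ Sum.elim (A⁻¹ *ᵥ (x - B *ᵥ z)) z = Sum.elim x y := by
    rw [fromBlocks_mulVec]
    simp only [Sum.elim_comp_inl, Sum.elim_comp_inr]
    congr 1
    · rw [mulVec_mulVec, mul_nonsing_inv _ hAd, one_mulVec, sub_add_cancel]
    · rw [mulVec_sub, mulVec_sub]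
      have : y = (D *ᵥ z - C *ᵥ (A⁻¹ *ᵥ (B *ᵥ z))) + C *ᵥ (A⁻¹ *ᵥ x) := by rw [hSz]; abel
      rw [this]; abel
  rw [← key, mulVec_mulVec, nonsing_inv_mul _ hM, one_mulVec]

end BlockMatrices

/-! ### The inverse Gaussian density as a function of the matrix, and its factorization. -/

section InverseGaussianDensity

variable {m n : Type*} [Fintype m] [Fintype n] [DecidableEq m] [DecidableEq n]

open Classical in
/-- The multivariate inverse Gaussian density with boundary condition `η`, as a function of the
matrix `M = H_β`. -/
noncomputable def igDensity (M : Matrix m m ℝ) (η : m → ℝ) : ℝ :=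
  if M.PosDef then
    (√(2 / Real.pi)) ^ Fintype.card m
        * Real.exp (-(1 / 2) *
            ((1 : m → ℝ) ⬝ᵥ (M *ᵥ 1) + η ⬝ᵥ (M⁻¹ *ᵥ η) - 2 * ((1 : m → ℝ) ⬝ᵥ η)))
        / √M.det
  else 0

theorem WeightedGraph.h22Density_eq_igDensity (G : WeightedGraph m) (η β : m → ℝ) :
    G.h22Density η β = igDensity (G.schrodinger β) η := by
  unfold WeightedGraph.h22Density igDensity
  classical
  rw [Set.indicator_apply]
  congr

theorem igDensity_nonneg (M : Matrix m m ℝ) (η : m → ℝ) : 0 ≤ igDensity M η := by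
  unfold igDensity
  split_ifs <;> positivity

theorem igDensity_submatrix (e : n ≃ m) (M : Matrix m m ℝ) (η : m → ℝ) :
    igDensity (M.submatrix e e) (η ∘ e) = igDensity M η := by
  have h1 : (M.submatrix e e) *ᵥ 1 = (M *ᵥ 1) ∘ e := by
    rw [submatrix_mulVec_equiv]; rfl
  have h2 : (M.submatrix e e)⁻¹ *ᵥ (η ∘ e) = (M⁻¹ *ᵥ η) ∘ e := by
    rw [inv_submatrix_equiv, submatrix_mulVec_equiv]; congr 2; ext; simp
  have hd (u v : m → ℝ) : (u ∘ e) ⬝ᵥ (v ∘ e) = u ⬝ᵥ v := comp_equiv_dotProduct_comp_equiv u v e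
  have h1' : (1 : n → ℝ) ⬝ᵥ (M.submatrix e e *ᵥ 1) = 1 ⬝ᵥ (M *ᵥ 1) := by rw [h1]; exact hd 1 _
  have h1'' : (1 : n → ℝ) ⬝ᵥ (η ∘ e) = 1 ⬝ᵥ η := hd 1 _
  have hp : (M.submatrix e e).PosDef ↔ M.PosDef := by
    constructor
    · intro h
      have := h.submatrix (e := e.symm) e.symm.injective
      simpa using this
    · exact fun h => h.submatrix e.injective
  unfold igDensity
  rw [h1', h2, h1'', hd, det_submatrix_equiv_self, Fintype.card_congr e]
  classical
  exact if_congr hp rfl rfl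

/-- With `w = B 1`, replacing `D` by its Schur complement `S` in `⟨1, D 1⟩` leaves `⟨w, A⁻¹ w⟩`,
which completes the square for the shifted boundary `x + w`. The cross term `2 ⟨w, A⁻¹ x⟩` of that
square cancels against the linear term of the transported boundary. Off the positive definite cone
both sides vanish. -/
theorem igDensity_fromBlocks {A : Matrix m m ℝ} (B : Matrix m n ℝ) (D : Matrix n n ℝ)
    (x : m → ℝ) (y : n → ℝ) :
    igDensity (fromBlocks A (-B) (-B)ᵀ D) (Sum.elim x y) =
      igDensity A (x + B *ᵥ 1) * igDensity (D - Bᵀ * A⁻¹ * B) (y + Bᵀ *ᵥ (A⁻¹ *ᵥ x)) := by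
  have hS : D - (-B)ᵀ * A⁻¹ * (-B) = D - Bᵀ * A⁻¹ * B := by simp
  have hpos := Matrix.PosDef.fromBlocks_iff (A := A) (-B) D
  rw [hS] at hpos
  by_cases hA : A.PosDef
  swap
  · rw [igDensity, igDensity, if_neg (fun h => hA (hpos.1 h).1), if_neg hA, zero_mul]
  by_cases hSp : (D - Bᵀ * A⁻¹ * B).PosDef
  swap
  · rw [igDensity, if_neg (fun h => hSp (hpos.1 h).2)]
    rw [igDensity.eq_1 (D - _), if_neg hSp, mul_zero]
  have hdet : (fromBlocks A (-B) (-B)ᵀ D).det = A.det * (D - Bᵀ * A⁻¹ * B).det := by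
    let _ : Invertible A := hA.isUnit.invertible
    rw [det_fromBlocks₁₁, invOf_eq_nonsing_inv, hS]
  have hinv := Matrix.inv_fromBlocks_mulVec (A := A) (-B) (-B)ᵀ D hA.isUnit (hS ▸ hSp.isUnit) x y
  rw [hS] at hinv
  set S := D - Bᵀ * A⁻¹ * B with hSdef
  have hD : D = S + Bᵀ * A⁻¹ * B := by simp [hSdef]
  have hsymm : ∀ u v : m → ℝ, u ⬝ᵥ (A⁻¹ *ᵥ v) = v ⬝ᵥ (A⁻¹ *ᵥ u) := by
    intro u v
    have hs : (A⁻¹)ᵀ = A⁻¹ := by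
      have := hA.inv.isHermitian
      rwa [Matrix.IsHermitian, conjTranspose_eq_transpose_of_trivial] at this
    rw [dotProduct_mulVec, ← mulVec_transpose, hs, dotProduct_comm]
  have hadj : ∀ (u : n → ℝ) (v : m → ℝ), u ⬝ᵥ (Bᵀ *ᵥ v) = (B *ᵥ u) ⬝ᵥ v := by
    intro u v
    rw [dotProduct_mulVec, ← mulVec_transpose, transpose_transpose]
  set z := S⁻¹ *ᵥ (y + Bᵀ *ᵥ (A⁻¹ *ᵥ x)) with hz
  have hz' : S⁻¹ *ᵥ (y - (-B)ᵀ *ᵥ (A⁻¹ *ᵥ x)) = z := by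
    simp [hz, neg_mulVec, transpose_neg]
  rw [hz'] at hinv
  have one_elim : (1 : m ⊕ n → ℝ) = Sum.elim (1 : m → ℝ) (1 : n → ℝ) := by ext i; cases i <;> rfl
  set w := B *ᵥ (1 : n → ℝ) with hw
  have e1 : (1 : m ⊕ n → ℝ) ⬝ᵥ (fromBlocks A (-B) (-B)ᵀ D *ᵥ 1)
      = 1 ⬝ᵥ (A *ᵥ 1) - 2 * (1 ⬝ᵥ w) + 1 ⬝ᵥ (S *ᵥ 1) + w ⬝ᵥ (A⁻¹ *ᵥ w) := by
    rw [one_elim, fromBlocks_mulVec, sumElim_dotProduct_sumElim]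
    simp only [Sum.elim_comp_inl, Sum.elim_comp_inr, dotProduct_add, neg_mulVec, dotProduct_neg,
      transpose_neg, hadj, hD, add_mulVec, ← mulVec_mulVec, ← hw]
    rw [dotProduct_comm w 1]; ring
  have e2 : Sum.elim x y ⬝ᵥ ((fromBlocks A (-B) (-B)ᵀ D)⁻¹ *ᵥ Sum.elim x y)
      = x ⬝ᵥ (A⁻¹ *ᵥ x) + (y + Bᵀ *ᵥ (A⁻¹ *ᵥ x)) ⬝ᵥ z := by
    rw [hinv, sumElim_dotProduct_sumElim]
    simp only [neg_mulVec, sub_neg_eq_add, mulVec_add, dotProduct_add, add_dotProduct]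
    rw [hsymm x (B *ᵥ z), dotProduct_comm (Bᵀ *ᵥ (A⁻¹ *ᵥ x)) z, hadj]; ring
  have e3 : (1 : m ⊕ n → ℝ) ⬝ᵥ Sum.elim x y = 1 ⬝ᵥ x + 1 ⬝ᵥ y := by
    rw [one_elim, sumElim_dotProduct_sumElim]
  have e4 : (x + w) ⬝ᵥ (A⁻¹ *ᵥ (x + w))
      = x ⬝ᵥ (A⁻¹ *ᵥ x) + 2 * (w ⬝ᵥ (A⁻¹ *ᵥ x)) + w ⬝ᵥ (A⁻¹ *ᵥ w) := by
    simp only [mulVec_add, dotProduct_add, add_dotProduct]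
    rw [hsymm x w]; ring
  have e5 : (1 : n → ℝ) ⬝ᵥ (y + Bᵀ *ᵥ (A⁻¹ *ᵥ x)) = 1 ⬝ᵥ y + w ⬝ᵥ (A⁻¹ *ᵥ x) := by
    rw [dotProduct_add, hadj]
  have e6 : (1 : m → ℝ) ⬝ᵥ (x + w) = 1 ⬝ᵥ x + 1 ⬝ᵥ w := dotProduct_add _ _ _
  unfold igDensity
  rw [if_pos (hpos.2 ⟨hA, hSp⟩), if_pos hA, if_pos hSp, hdet, Real.sqrt_mul hA.det_pos.le,
    Fintype.card_sum, pow_add, e1, e2, e3, e4, e5, e6, div_mul_div_comm]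
  congr 1
  rw [mul_mul_mul_comm, ← Real.exp_add]
  congr 2
  ring

/-- The one-vertex case of `igDensity`, in terms of the matrix entry `s`. -/
noncomputable def scalarDensity (s y : ℝ) : ℝ :=
  if 0 < s then √(2 / Real.pi) * Real.exp (-(1 / 2) * (s + y ^ 2 / s - 2 * y)) / √s else 0

theorem posDef_unique_iff {ι : Type*} [Unique ι] [Fintype ι] (M : Matrix ι ι ℝ) :
    M.PosDef ↔ 0 < M default default := by
  rw [posDef_iff_dotProduct_mulVec]
  constructor
  · rintro ⟨-, h⟩
    have := h (x := 1) one_ne_zero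
    simpa [dotProduct, mulVec, Fintype.sum_unique] using this
  · intro h
    refine ⟨?_, fun x hx => ?_⟩
    · ext i j
      simp [Subsingleton.elim i j]
    · have hx0 : x default ≠ 0 := fun h0 => hx (funext fun i => by
        rw [Subsingleton.elim i default, h0]; rfl)
      have : 0 < x default * x default := mul_self_pos.2 hx0
      simp only [star_trivial, dotProduct, mulVec, Fintype.sum_unique]
      nlinarith [mul_pos h this]

theorem inv_unique_apply {ι : Type*} [Unique ι] [Fintype ι] [DecidableEq ι] (M : Matrix ι ι ℝ) :
    M⁻¹ default default = (M default default)⁻¹ := by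
  rw [inv_subsingleton]; simp

theorem igDensity_unique {ι : Type*} [Unique ι] [Fintype ι] [DecidableEq ι] (M : Matrix ι ι ℝ)
    (y : ι → ℝ) : igDensity M y = scalarDensity (M default default) (y default) := by
  unfold igDensity scalarDensity
  simp only [posDef_unique_iff, det_unique, Fintype.card_unique, pow_one, dotProduct, mulVec,
    Fintype.sum_unique, inv_unique_apply, Pi.one_apply]
  congr 6 <;> ring

end InverseGaussianDensity

/-! ### Normalization of the one-vertex law. -/

section ScalarDensity

open Set

theorem scalarDensity_nonneg (s y : ℝ) : 0 ≤ scalarDensity s y := by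
  unfold scalarDensity
  split_ifs <;> positivity

theorem measurable_scalarDensity : Measurable (fun p : ℝ × ℝ => scalarDensity p.1 p.2) := by
  unfold scalarDensity
  exact Measurable.ite (measurableSet_lt measurable_const measurable_fst) (by fun_prop)
    measurable_const

theorem lintegral_gaussian :
    ∫⁻ x : ℝ, ENNReal.ofReal (Real.exp (-(1 / 2) * x ^ 2)) = ENNReal.ofReal √(2 * Real.pi) := by
  rw [← ofReal_integral_eq_lintegral_ofReal (integrable_exp_neg_mul_sq (by norm_num))
    (ae_of_all _ fun x => (Real.exp_pos _).le), integral_gaussian]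
  congr 2
  ring

theorem lintegral_gaussian_Ioi :
    2 * ∫⁻ x in Ioi (0 : ℝ), ENNReal.ofReal (Real.exp (-(1 / 2) * x ^ 2)) =
      ENNReal.ofReal √(2 * Real.pi) := by
  rw [← ofReal_integral_eq_lintegral_ofReal
    (integrable_exp_neg_mul_sq (by norm_num)).integrableOn
    (ae_of_all _ fun x => (Real.exp_pos _).le), integral_gaussian_Ioi,
    ← ENNReal.ofReal_ofNat 2, ← ENNReal.ofReal_mul (by norm_num)]
  congr 1
  rw [show Real.pi / (1 / 2) = 2 * Real.pi by ring]
  ring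

theorem hasDerivAt_sub_div (y : ℝ) {s : ℝ} (hs : s ≠ 0) :
    HasDerivAt (fun s : ℝ => s - y / s) (1 + y / s ^ 2) s := by
  have := (hasDerivAt_id s).sub ((hasDerivAt_const s y).div (hasDerivAt_id s) hs)
  refine this.congr_deriv ?_
  simp; ring

theorem hasDerivAt_const_div (y : ℝ) {s : ℝ} (hs : s ≠ 0) :
    HasDerivAt (fun s : ℝ => y / s) (-(y / s ^ 2)) s := by
  have := (hasDerivAt_const s y).div (hasDerivAt_id s) hs
  refine this.congr_deriv ?_
  simp; ring

theorem image_sub_div_Ioi {y : ℝ} (hy : 0 < y) : (fun s : ℝ => s - y / s) '' Ioi 0 = univ := by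
  refine eq_univ_of_forall fun x => ?_
  have h : 0 ≤ x ^ 2 + 4 * y := by positivity
  have hq := Real.sq_sqrt h
  have hlt : |x| < √(x ^ 2 + 4 * y) := by
    rw [← Real.sqrt_sq_eq_abs]
    exact Real.sqrt_lt_sqrt (sq_nonneg x) (by linarith)
  have hpos : 0 < (x + √(x ^ 2 + 4 * y)) / 2 := by
    have := neg_abs_le x
    linarith
  -- The positive root of `s² - x s - y = 0`.
  refine ⟨(x + √(x ^ 2 + 4 * y)) / 2, hpos, ?_⟩
  simp only
  rw [sub_eq_iff_eq_add, ← sub_eq_iff_eq_add', eq_div_iff hpos.ne']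
  nlinarith

theorem strictMonoOn_sub_div {y : ℝ} (hy : 0 ≤ y) :
    StrictMonoOn (fun s : ℝ => s - y / s) (Ioi 0) := by
  intro a ha b hb hab
  have : y / b ≤ y / a := div_le_div_of_nonneg_left hy ha hab.le
  simp only
  linarith

/-- The Cauchy–Schlömilch substitution. -/
theorem lintegral_gaussian_sub_div {y : ℝ} (hy : 0 ≤ y) :
    2 * ∫⁻ s in Ioi (0 : ℝ), ENNReal.ofReal (Real.exp (-(1 / 2) * (s - y / s) ^ 2)) =
      ENNReal.ofReal √(2 * Real.pi) := by
  rcases hy.eq_or_lt with rfl | hy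
  · simpa using lintegral_gaussian_Ioi
  set f : ℝ → ENNReal := fun x => ENNReal.ofReal (Real.exp (-(1 / 2) * x ^ 2)) with hf
  have hfm : Measurable f := by fun_prop
  -- The involution `s ↦ y / s` flips the sign of `s - y / s`, and `f` is even; only the Jacobian `y
  -- / s²` appears.
  have h1 : ∫⁻ s in Ioi (0 : ℝ), f (s - y / s)
      = ∫⁻ s in Ioi (0 : ℝ), ENNReal.ofReal (y / s ^ 2) * f (s - y / s) := by
    have himg : (fun s : ℝ => y / s) '' Ioi 0 = Ioi 0 := by
      ext x
      constructor
      · rintro ⟨s, hs, rfl⟩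
        exact div_pos hy hs
      · intro hx
        exact ⟨y / x, div_pos hy hx, div_div_cancel₀ hy.ne'⟩
    have hinj : InjOn (fun s : ℝ => y / s) (Ioi 0) := by
      intro a ha b hb hab
      have ha' : a ≠ 0 := ne_of_gt ha
      have hb' : b ≠ 0 := ne_of_gt hb
      simp only at hab
      field_simp at hab
      exact hab.symm
    have := lintegral_image_eq_lintegral_abs_deriv_mul measurableSet_Ioi
      (fun s hs => (hasDerivAt_const_div y (ne_of_gt hs)).hasDerivWithinAt) hinj
      (fun s => f (s - y / s))
    rw [himg] at this
    rw [this]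
    refine setLIntegral_congr_fun measurableSet_Ioi fun s hs => ?_
    have hs' : s ≠ 0 := ne_of_gt hs
    simp only [hf, abs_neg, abs_of_pos (div_pos hy (pow_pos hs 2)), div_div_cancel₀ hy.ne']
    congr 4
    ring
  -- The substitution `x = s - y / s` has Jacobian `1 + y / s²`, the sum of the two weights in `h1`.
  have h2 : ∫⁻ x, f x
      = ∫⁻ s in Ioi (0 : ℝ), ENNReal.ofReal (1 + y / s ^ 2) * f (s - y / s) := by
    have := lintegral_image_eq_lintegral_abs_deriv_mul measurableSet_Ioi
      (fun s hs => (hasDerivAt_sub_div y (ne_of_gt hs)).hasDerivWithinAt)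
      (strictMonoOn_sub_div hy.le).injOn f
    rw [image_sub_div_Ioi hy, setLIntegral_univ] at this
    rw [this]
    refine setLIntegral_congr_fun measurableSet_Ioi fun s hs => ?_
    rw [abs_of_pos]
    positivity
  calc 2 * ∫⁻ s in Ioi (0 : ℝ), f (s - y / s)
      = (∫⁻ s in Ioi (0 : ℝ), f (s - y / s))
          + ∫⁻ s in Ioi (0 : ℝ), ENNReal.ofReal (y / s ^ 2) * f (s - y / s) := by
        rw [← h1, two_mul]
    _ = ∫⁻ s in Ioi (0 : ℝ), ENNReal.ofReal (1 + y / s ^ 2) * f (s - y / s) := by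
        rw [← lintegral_add_left (by fun_prop)]
        refine setLIntegral_congr_fun measurableSet_Ioi fun s hs => ?_
        rw [ENNReal.ofReal_add zero_le_one (by positivity), add_mul, ENNReal.ofReal_one, one_mul]
    _ = _ := by rw [← h2, hf, lintegral_gaussian]

/-- The one-vertex law is a probability measure. -/
theorem lintegral_scalarDensity (k : ℝ) {y : ℝ} (hy : 0 ≤ y) :
    ∫⁻ b : ℝ, ENNReal.ofReal (scalarDensity (2 * b - k) y) = 1 := by
  -- Substituting `2 b - k = s²`, the Jacobian `s` cancels the square root in the denominator and
  -- the exponent becomes `-(s - y / s)² / 2`.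
  have himg : (fun s : ℝ => (s ^ 2 + k) / 2) '' Ioi 0 = Ioi (k / 2) := by
    ext x
    constructor
    · rintro ⟨s, hs, rfl⟩
      have : 0 < s ^ 2 := pow_pos hs 2
      simp only [mem_Ioi]
      linarith
    · intro hx
      simp only [mem_Ioi] at hx
      refine ⟨√(2 * x - k), Real.sqrt_pos.2 (by linarith), ?_⟩
      simp only
      rw [Real.sq_sqrt (by linarith)]
      ring
  have hinj : InjOn (fun s : ℝ => (s ^ 2 + k) / 2) (Ioi 0) := by
    intro a ha b hb hab
    have : a ^ 2 = b ^ 2 := by simp only at hab; linarith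
    exact (pow_left_inj₀ (le_of_lt ha) (le_of_lt hb) two_ne_zero).1 this
  have hd : ∀ s ∈ Ioi (0 : ℝ), HasDerivWithinAt (fun s : ℝ => (s ^ 2 + k) / 2) s (Ioi 0) s := by
    intro s _
    have := (((hasDerivAt_pow 2 s).add_const k).div_const 2).hasDerivWithinAt (s := Ioi 0)
    refine this.congr_deriv ?_
    simp
  have hsupp : ∫⁻ b : ℝ, ENNReal.ofReal (scalarDensity (2 * b - k) y)
      = ∫⁻ b in Ioi (k / 2), ENNReal.ofReal (scalarDensity (2 * b - k) y) := by
    rw [← lintegral_indicator measurableSet_Ioi]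
    refine lintegral_congr fun b => ?_
    by_cases hb : b ∈ Ioi (k / 2)
    · rw [indicator_of_mem hb]
    · rw [indicator_of_notMem hb, scalarDensity, if_neg, ENNReal.ofReal_zero]
      simp only [mem_Ioi] at hb
      linarith
  rw [hsupp, ← himg, lintegral_image_eq_lintegral_abs_deriv_mul measurableSet_Ioi hd hinj]
  have : ∀ s ∈ Ioi (0 : ℝ), ENNReal.ofReal |s|
        * ENNReal.ofReal (scalarDensity (2 * ((s ^ 2 + k) / 2) - k) y)
      = ENNReal.ofReal √(2 / Real.pi)
        * ENNReal.ofReal (Real.exp (-(1 / 2) * (s - y / s) ^ 2)) := by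
    intro s hs
    have hs0 : 0 < s := hs
    rw [← ENNReal.ofReal_mul (abs_nonneg s), ← ENNReal.ofReal_mul (Real.sqrt_nonneg _)]
    congr 1
    rw [show 2 * ((s ^ 2 + k) / 2) - k = s ^ 2 by ring, scalarDensity, if_pos (pow_pos hs0 2),
      Real.sqrt_sq hs0.le, abs_of_pos hs0]
    field_simp
    congr 1
    ring
  rw [setLIntegral_congr_fun measurableSet_Ioi this,
    lintegral_const_mul _ (by fun_prop)]
  have h2 := lintegral_gaussian_sub_div hy
  have h3 : ENNReal.ofReal √(2 / Real.pi) * ENNReal.ofReal √(2 * Real.pi) = 2 := by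
    rw [← ENNReal.ofReal_mul (Real.sqrt_nonneg _), ← Real.sqrt_mul (by positivity),
      show 2 / Real.pi * (2 * Real.pi) = 2 ^ 2 by field_simp,
      Real.sqrt_sq (by norm_num)]
    simp
  rw [← h2, mul_left_comm] at h3
  exact (ENNReal.mul_right_inj (a := 2) (by simp) (by simp)).1 (by rw [h3, mul_one])

end ScalarDensity

/-! ### Positivity of the inverse of an M-matrix. -/

section MMatrix

variable {m : Type*} [Fintype m] [DecidableEq m]

/-- The inverse of a positive definite matrix with nonpositive off-diagonal entries preserves
the cone of nonnegative vectors. -/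
theorem Matrix.PosDef.inv_mulVec_nonneg {A : Matrix m m ℝ} (hA : A.PosDef)
    (hoff : ∀ i j, i ≠ j → A i j ≤ 0) {y : m → ℝ} (hy : ∀ i, 0 ≤ y i) (i : m) :
    0 ≤ (A⁻¹ *ᵥ y) i := by
  set x := A⁻¹ *ᵥ y with hx
  have hAx : A *ᵥ x = y := by
    rw [hx, mulVec_mulVec, mul_nonsing_inv _ ((isUnit_iff_isUnit_det A).1 hA.isUnit), one_mulVec]
  -- The negative part of `x` is tested against `A`: the off-diagonal signs give `⟨u, A u⟩ ≤ -⟨u, A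
  -- x⟩ = -⟨u, y⟩ ≤ 0`, and definiteness forces `u = 0`.
  set u : m → ℝ := fun i => max (-x i) 0 with hu
  have hu0 : ∀ i, 0 ≤ u i := fun i => le_max_right _ _
  have hle : u ⬝ᵥ (A *ᵥ u) ≤ -(u ⬝ᵥ y) := by
    rw [← hAx, ← dotProduct_neg, ← mulVec_neg]
    simp only [dotProduct, mulVec, Finset.mul_sum]
    refine Finset.sum_le_sum fun i _ => Finset.sum_le_sum fun j _ => ?_
    have hxj : -x j ≤ u j := le_max_left _ _
    rcases eq_or_ne i j with rfl | hij
    · refine le_of_eq ?_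
      rcases le_total (-x i) 0 with h | h
      · simp [hu, max_eq_right h]
      · simp [hu, max_eq_left h]
    · have := mul_le_mul_of_nonpos_left hxj (hoff i j hij)
      exact mul_le_mul_of_nonneg_left this (hu0 i)
  have hnonneg : 0 ≤ u ⬝ᵥ y := Finset.sum_nonneg fun i _ => mul_nonneg (hu0 i) (hy i)
  have hzero : u = 0 := by
    by_contra hne
    have := (posDef_iff_dotProduct_mulVec.1 hA).2 hne
    rw [star_trivial] at this
    linarith
  have := congrFun hzero i
  have h2 : -x i ≤ u i := le_max_left _ _
  rw [this, Pi.zero_apply] at h2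
  linarith

end MMatrix

/-! ### Lebesgue integrals over split index sets. -/

section Splitting

variable {m n V : Type*} [Fintype m] [Fintype n] [Fintype V]

theorem lintegral_pi_sum (e : m ⊕ n ≃ V) {f : (V → ℝ) → ENNReal} (hf : Measurable f) :
    ∫⁻ β, f β = ∫⁻ a : m → ℝ, ∫⁻ b : n → ℝ, f (Sum.elim a b ∘ e.symm) := by
  have h1 := (volume_measurePreserving_piCongrLeft (fun _ : V => ℝ) e).lintegral_comp hf
  have h2 := (volume_measurePreserving_sumPiEquivProdPi_symm (fun _ : m ⊕ n => ℝ)).lintegral_comp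
    (hf.comp (MeasurableEquiv.piCongrLeft (fun _ : V => ℝ) e).measurable)
  rw [← h1]
  refine h2.symm.trans ?_
  rw [Measure.volume_eq_prod, lintegral_prod]
  · refine lintegral_congr fun a => lintegral_congr fun b => ?_
    simp only [Function.comp]
    congr 1
    ext v
    obtain ⟨s, rfl⟩ := e.surjective v
    rw [MeasurableEquiv.coe_piCongrLeft, Equiv.piCongrLeft_apply_apply, Function.comp,
      e.symm_apply_apply]
    cases s <;> rfl
  · exact ((hf.comp (MeasurableEquiv.piCongrLeft (fun _ : V => ℝ) e).measurable).comp
      (MeasurableEquiv.measurable _)).aemeasurable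

/-- Relabelling the summands gives the other order of integration; the coarse-graining argument
fixes the coordinates outside `U` first. -/
theorem lintegral_pi_sum_swap (e : m ⊕ n ≃ V) {f : (V → ℝ) → ENNReal} (hf : Measurable f) :
    ∫⁻ β, f β = ∫⁻ b : n → ℝ, ∫⁻ a : m → ℝ, f (Sum.elim a b ∘ e.symm) := by
  rw [lintegral_pi_sum ((Equiv.sumComm n m).trans e) hf]
  refine lintegral_congr fun b => lintegral_congr fun a => ?_
  congr 1
  ext v
  simp only [Function.comp, Equiv.symm_trans_apply]
  cases e.symm v <;> rfl

theorem lintegral_pi_unit {f : (Unit → ℝ) → ENNReal} (hf : Measurable f) :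
    ∫⁻ b, f b = ∫⁻ x : ℝ, f (fun _ => x) := by
  have := (volume_preserving_funUnique Unit ℝ).symm.lintegral_comp hf
  exact this.symm

end Splitting

/-! ### Splitting one vertex off: coordinates. -/

section Vertex

variable {V : Type*} [DecidableEq V]

/-- A vertex split off from the rest. -/
def vertexEquiv (i₀ : V) : {j // j ≠ i₀} ⊕ Unit ≃ V where
  toFun := Sum.elim (fun j => j) (fun _ => i₀)
  invFun v := if h : v = i₀ then Sum.inr () else Sum.inl ⟨v, h⟩
  left_inv := by
    rintro (⟨j, hj⟩ | ⟨⟩)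
    · simp [hj]
    · simp
  right_inv v := by
    by_cases h : v = i₀ <;> simp [h]

/-- The potential with value `x` at `i₀` and values `a` elsewhere. -/
def vertexPoint (i₀ : V) (x : ℝ) (a : {j // j ≠ i₀} → ℝ) : V → ℝ :=
  fun i => if h : i = i₀ then x else a ⟨i, h⟩

theorem sumElim_comp_vertexEquiv_symm (i₀ : V) (x : ℝ) (a : {j // j ≠ i₀} → ℝ) :
    Sum.elim a (fun _ => x) ∘ (vertexEquiv i₀).symm = vertexPoint i₀ x a := by
  ext v
  by_cases h : v = i₀ <;> simp [vertexEquiv, vertexPoint, h]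

@[simp]
theorem vertexPoint_self (i₀ : V) (x : ℝ) (a : {j // j ≠ i₀} → ℝ) :
    vertexPoint i₀ x a i₀ = x := by
  simp [vertexPoint]

theorem measurable_vertexPoint (i₀ : V) :
    Measurable (fun p : ℝ × ({j // j ≠ i₀} → ℝ) => vertexPoint i₀ p.1 p.2) := by
  refine measurable_pi_lambda _ fun i => ?_
  unfold vertexPoint
  by_cases h : i = i₀
  · simp only [h, dite_true]
    exact measurable_fst
  · simp only [h, dite_false]
    exact (measurable_pi_apply _).comp measurable_snd

theorem lintegral_vertex [Fintype V] (i₀ : V) {f : (V → ℝ) → ENNReal} (hf : Measurable f) :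
    ∫⁻ β, f β = ∫⁻ a : {j // j ≠ i₀} → ℝ, ∫⁻ x : ℝ, f (vertexPoint i₀ x a) := by
  rw [lintegral_pi_sum (vertexEquiv i₀) hf]
  refine lintegral_congr fun a => ?_
  rw [lintegral_pi_unit]
  · simp_rw [sumElim_comp_vertexEquiv_symm]
  · refine hf.comp (measurable_pi_lambda _ fun v => ?_)
    simp only [Function.comp]
    cases (vertexEquiv i₀).symm v with
    | inl j => exact measurable_const
    | inr u => exact measurable_pi_apply u

end Vertex

/-! ### Splitting one vertex off: the operator, its pivot and the density. -/

namespace WeightedGraph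

variable {V : Type*}

/-- The block of the weights between `i₀` and the other vertices. -/
def vertexWeight (G : WeightedGraph V) (i₀ : V) : {j // j ≠ i₀} → ℝ :=
  fun j => G.weight i₀ j

theorem vertexWeight_nonneg (G : WeightedGraph V) (i₀ : V) (j) : 0 ≤ G.vertexWeight i₀ j :=
  G.nonneg _ _

variable [DecidableEq V]

theorem schrodinger_apply_ne (G : WeightedGraph V) (β : V → ℝ) {i j : V} (h : i ≠ j) :
    G.schrodinger β i j = -G.weight i j := by
  simp [schrodinger, h]

theorem schrodinger_apply_self (G : WeightedGraph V) (β : V → ℝ) (i : V) :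
    G.schrodinger β i i = 2 * β i := by
  simp [schrodinger, G.loopless]

theorem continuous_schrodinger (G : WeightedGraph V) : Continuous G.schrodinger := by
  refine continuous_matrix fun i j => ?_
  simp only [schrodinger, Matrix.sub_apply, diagonal_apply]
  by_cases h : i = j
  · simp only [h, if_true]; fun_prop
  · simp only [h, if_false]; fun_prop

theorem isHermitian_schrodinger (G : WeightedGraph V) (β : V → ℝ) :
    (G.schrodinger β).IsHermitian := by
  refine IsHermitian.ext fun i j => ?_
  rcases eq_or_ne i j with rfl | h
  · rfl
  · rw [schrodinger_apply_ne _ _ h, schrodinger_apply_ne _ _ h.symm, G.symm]; rfl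

theorem schrodinger_induce (G : WeightedGraph V) (p : V → Prop) (β : V → ℝ) :
    (G.induce p).schrodinger (fun i : {i // p i} => β i) =
      (G.schrodinger β).submatrix (fun i : {i // p i} => (i : V)) (fun i : {i // p i} => (i : V)) := by
  ext i j
  rcases eq_or_ne i j with rfl | h
  · rw [schrodinger_apply_self, submatrix_apply, schrodinger_apply_self]
  · rw [schrodinger_apply_ne _ _ h, submatrix_apply, schrodinger_apply_ne]
    · rfl
    · exact fun h' => h (Subtype.ext h')

theorem schrodinger_vertexPoint (G : WeightedGraph V) (i₀ : V) (x : ℝ) (a : {j // j ≠ i₀} → ℝ) :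
    (G.schrodinger (vertexPoint i₀ x a)).submatrix (vertexEquiv i₀) (vertexEquiv i₀) =
      fromBlocks ((G.induce (· ≠ i₀)).schrodinger a) (-(replicateCol Unit (G.vertexWeight i₀)))
        (-(replicateCol Unit (G.vertexWeight i₀)))ᵀ (Matrix.of fun _ _ => 2 * x) := by
  have ha : a = fun j : {j // j ≠ i₀} => vertexPoint i₀ x a j := by
    ext j
    simp [vertexPoint, j.2]
  have hA := G.schrodinger_induce (· ≠ i₀) (vertexPoint i₀ x a)
  rw [← ha] at hA
  rw [hA]
  ext (i | i) (j | j)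
  · rfl
  · simp only [submatrix_apply, vertexEquiv, Equiv.coe_fn_mk, Sum.elim_inl, Sum.elim_inr,
      fromBlocks_apply₁₂]
    rw [schrodinger_apply_ne _ _ i.2, G.symm]
    rfl
  · simp only [submatrix_apply, vertexEquiv, Equiv.coe_fn_mk, Sum.elim_inl, Sum.elim_inr,
      fromBlocks_apply₂₁]
    rw [schrodinger_apply_ne _ _ j.2.symm]
    rfl
  · simp [vertexEquiv, schrodinger_apply_self]

theorem pos_of_posDef (G : WeightedGraph V) {β : V → ℝ} (h : (G.schrodinger β).PosDef) (i : V) :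
    0 < β i := by
  have := h.diag_pos (i := i)
  rw [schrodinger_apply_self] at this
  linarith

variable [Fintype V]

theorem schrodinger_inv_mulVec_nonneg (G : WeightedGraph V) {β : V → ℝ}
    (h : (G.schrodinger β).PosDef) {y : V → ℝ} (hy : ∀ i, 0 ≤ y i) (i : V) :
    0 ≤ ((G.schrodinger β)⁻¹ *ᵥ y) i :=
  h.inv_mulVec_nonneg (fun i j hij => by
    rw [schrodinger_apply_ne _ _ hij]; exact neg_nonpos.2 (G.nonneg i j)) hy i

/-- The block of `H_β` on the complement of `i₀`, inverted. -/
noncomputable def vertexInv (G : WeightedGraph V) (i₀ : V) (a : {j // j ≠ i₀} → ℝ) :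
    Matrix {j // j ≠ i₀} {j // j ≠ i₀} ℝ :=
  ((G.induce (· ≠ i₀)).schrodinger a)⁻¹

/-- The pivot of `H_β` at `i₀` after elimination of the other vertices. -/
noncomputable def pivot (G : WeightedGraph V) (i₀ : V) (x : ℝ) (a : {j // j ≠ i₀} → ℝ) : ℝ :=
  2 * x - G.vertexWeight i₀ ⬝ᵥ (G.vertexInv i₀ a *ᵥ G.vertexWeight i₀)

theorem schur_vertex_apply (G : WeightedGraph V) (i₀ : V) (x : ℝ) (a : {j // j ≠ i₀} → ℝ) :
    ((Matrix.of fun _ _ => 2 * x) - (replicateCol Unit (G.vertexWeight i₀))ᵀ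
      * ((G.induce (· ≠ i₀)).schrodinger a)⁻¹ * replicateCol Unit (G.vertexWeight i₀) :
        Matrix Unit Unit ℝ) () () = G.pivot i₀ x a := by
  rw [Matrix.mul_assoc]
  simp only [pivot, vertexInv, Matrix.sub_apply, of_apply, mul_apply, transpose_apply, replicateCol_apply,
    dotProduct, mulVec]

/-- The block factorization with `i₀` as second block: the variable `x` occurs only in a one-vertex
density, and the other factor is again of inverse Gaussian type on a smaller graph. -/
theorem h22Density_vertexPoint (G : WeightedGraph V) (i₀ : V) (η : V → ℝ) (x : ℝ)
    (a : {j // j ≠ i₀} → ℝ) :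
    G.h22Density η (vertexPoint i₀ x a) =
      (G.induce (· ≠ i₀)).h22Density ((fun j : {j // j ≠ i₀} => η j) + G.vertexWeight i₀) a *
        scalarDensity (G.pivot i₀ x a)
          (η i₀ + G.vertexWeight i₀ ⬝ᵥ (G.vertexInv i₀ a *ᵥ fun j : {j // j ≠ i₀} => η j)) := by
  have hη : η ∘ vertexEquiv i₀ = Sum.elim (fun j : {j // j ≠ i₀} => η j) (fun _ => η i₀) := by
    ext (i | i) <;> rfl
  rw [h22Density_eq_igDensity, ← igDensity_submatrix (vertexEquiv i₀), schrodinger_vertexPoint, hη,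
    igDensity_fromBlocks, igDensity_unique (ι := Unit), h22Density_eq_igDensity]
  congr 2
  · ext j
    simp [mulVec, dotProduct]
  · exact G.schur_vertex_apply i₀ x a

theorem posDef_vertexPoint_iff (G : WeightedGraph V) (i₀ : V) (x : ℝ) (a : {j // j ≠ i₀} → ℝ) :
    (G.schrodinger (vertexPoint i₀ x a)).PosDef ↔
      ((G.induce (· ≠ i₀)).schrodinger a).PosDef ∧ 0 < G.pivot i₀ x a := by
  have h : (G.schrodinger (vertexPoint i₀ x a)).PosDef ↔
      ((G.schrodinger (vertexPoint i₀ x a)).submatrix (vertexEquiv i₀) (vertexEquiv i₀)).PosDef := by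
    constructor
    · exact fun h => h.submatrix (vertexEquiv i₀).injective
    · intro h
      simpa using h.submatrix (vertexEquiv i₀).symm.injective
  rw [h, schrodinger_vertexPoint, PosDef.fromBlocks_iff, posDef_unique_iff (ι := Unit),
    ← G.schur_vertex_apply i₀ x a]
  simp

/-! ### Measurability in the potential. -/

section Measurability

theorem measurable_schrodinger (G : WeightedGraph V) (i j : V) :
    Measurable fun β : V → ℝ => G.schrodinger β i j :=
  (G.continuous_schrodinger.matrix_elem i j).measurable

theorem _root_.Matrix.measurable_inv_apply {α : Type*} [MeasurableSpace α] {A : α → Matrix V V ℝ}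
    (hA : ∀ i j, Measurable fun x => A x i j) (i j : V) :
    Measurable fun x => (A x)⁻¹ i j := by
  have hdet : ∀ {B : α → Matrix V V ℝ}, (∀ i j, Measurable fun x => B x i j) →
      Measurable fun x => (B x).det := by
    intro B hB
    simp only [det_apply]
    exact Finset.measurable_sum _ fun σ _ => (Finset.measurable_prod _ fun k _ => hB _ _).const_smul _
  -- Cramer's rule, valid also at singular matrices, where the inverse is zero by convention.
  simp only [inv_def, Matrix.smul_apply, Ring.inverse_eq_inv', smul_eq_mul]
  refine (hdet hA).inv.mul ?_
  simp only [adjugate_apply]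
  refine hdet fun k l => ?_
  simp only [updateRow_apply]
  by_cases h : k = j
  · simp only [h, if_true]; exact measurable_const
  · simp only [h, if_false]; exact hA k l

theorem measurable_schrodinger_inv (G : WeightedGraph V) (i j : V) :
    Measurable fun β : V → ℝ => (G.schrodinger β)⁻¹ i j :=
  Matrix.measurable_inv_apply G.measurable_schrodinger i j

theorem measurable_schrodinger_inv_mulVec (G : WeightedGraph V) (y : V → ℝ) (i : V) :
    Measurable fun β : V → ℝ => ((G.schrodinger β)⁻¹ *ᵥ y) i := by
  simp only [mulVec, dotProduct]
  exact Finset.measurable_sum _ fun j _ => (G.measurable_schrodinger_inv i j).mul_const _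

theorem measurable_dotProduct_schrodinger_inv (G : WeightedGraph V) (x y : V → ℝ) :
    Measurable fun β : V → ℝ => x ⬝ᵥ ((G.schrodinger β)⁻¹ *ᵥ y) := by
  simp only [dotProduct]
  exact Finset.measurable_sum _ fun i _ => (G.measurable_schrodinger_inv_mulVec y i).const_mul _

theorem measurable_reducedPotential (G : WeightedGraph V) : Measurable G.reducedPotential := by
  unfold reducedPotential
  refine Measurable.const_div (Measurable.const_mul ?_ _) _
  exact Finset.measurable_sum _ fun i _ => Finset.measurable_sum _ fun j _ =>
    G.measurable_schrodinger_inv i j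

/-- Semidefiniteness is a closed condition, and a nonvanishing determinant, an open one, singles out
the definite matrices among the semidefinite ones. -/
theorem measurableSet_posDef (G : WeightedGraph V) :
    MeasurableSet {β : V → ℝ | (G.schrodinger β).PosDef} := by
  have h : {β : V → ℝ | (G.schrodinger β).PosDef} =
      {β | ∀ x : V → ℝ, 0 ≤ x ⬝ᵥ (G.schrodinger β *ᵥ x)} ∩ {β | (G.schrodinger β).det ≠ 0} := by
    ext β
    constructor
    · intro h
      refine ⟨fun x => ?_, h.det_pos.ne'⟩
      simpa using (posSemidef_iff_dotProduct_mulVec.1 h.posSemidef).2 x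
    · rintro ⟨h, hdet⟩
      have hp : (G.schrodinger β).PosSemidef :=
        posSemidef_iff_dotProduct_mulVec.2 ⟨G.isHermitian_schrodinger β, fun x => by simpa using h x⟩
      exact hp.posDef_iff_det_ne_zero.2 hdet
  have hc := G.continuous_schrodinger
  rw [h]
  refine IsClosed.measurableSet ?_ |>.inter (IsOpen.measurableSet ?_)
  · simp only [Set.ofPred_forall]
    exact isClosed_iInter fun x => isClosed_le continuous_const (by fun_prop)
  · exact isOpen_ne_fun (by fun_prop) continuous_const

theorem measurable_h22Density (G : WeightedGraph V) (η : V → ℝ) :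
    Measurable (G.h22Density η) := by
  have hc := G.continuous_schrodinger
  have h1 : Measurable fun β => (1 : V → ℝ) ⬝ᵥ (G.schrodinger β *ᵥ 1) :=
    Continuous.measurable (by fun_prop)
  have h2 : Measurable fun β => (G.schrodinger β).det := Continuous.measurable (by fun_prop)
  refine Measurable.indicator ?_ G.measurableSet_posDef
  exact (((((h1.add (G.measurable_dotProduct_schrodinger_inv η η)).sub_const _).const_mul _).exp
    ).const_mul _).div h2.sqrt

end Measurability

end WeightedGraph

/-! ### Normalization of the inverse Gaussian law. -/

namespace WeightedGraph

section Normalization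

/-- Induction on the number of vertices: integrating the coordinate at `i₀` first gives one, and the
induced graph with boundary `η + w` remains. The boundary has to vary in the induction. -/
theorem lintegral_h22Density_aux (k : ℕ) : ∀ {V : Type*} [Fintype V] [DecidableEq V],
    Fintype.card V = k → ∀ (G : WeightedGraph V) {η : V → ℝ}, (∀ i, 0 ≤ η i) →
      ∫⁻ β, ENNReal.ofReal (G.h22Density η β) = 1 := by
  induction k with
  | zero =>
    intro V _ _ hV G η _
    have : IsEmpty V := Fintype.card_eq_zero_iff.1 hV
    rw [volume_pi, Measure.pi_of_empty _ (0 : V → ℝ), lintegral_dirac,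
      h22Density_eq_igDensity, igDensity, if_pos]
    · simp
    · refine posDef_iff_dotProduct_mulVec.2 ⟨isHermitian_schrodinger _ _, fun x hx => ?_⟩
      exact absurd (Subsingleton.elim x 0) hx
  | succ k ih =>
    intro V _ _ hV G η hη
    obtain ⟨i₀⟩ : Nonempty V := Fintype.card_pos_iff.1 (by omega)
    have hcard : Fintype.card {j // j ≠ i₀} = k := by
      rw [Fintype.card_subtype_compl, Fintype.card_subtype_eq, hV]; rfl
    rw [lintegral_vertex i₀ (G.measurable_h22Density η).ennreal_ofReal,
      ← ih hcard (G.induce (· ≠ i₀)) (η := (fun j : {j // j ≠ i₀} => η j) + G.vertexWeight i₀)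
        (fun j => add_nonneg (hη j) (G.vertexWeight_nonneg i₀ j))]
    refine lintegral_congr fun a => ?_
    simp_rw [h22Density_vertexPoint, ENNReal.ofReal_mul (igDensity_nonneg _ _ |>.trans_eq
      (h22Density_eq_igDensity _ _ _).symm)]
    by_cases ha : ((G.induce (· ≠ i₀)).schrodinger a).PosDef
    · rw [lintegral_const_mul' _ _ ENNReal.ofReal_ne_top]
      unfold pivot
      rw [lintegral_scalarDensity, mul_one]
      -- The one-vertex normalization needs a nonnegative boundary value; this is where the M-matrix
      -- property enters.
      refine add_nonneg (hη i₀) (Finset.sum_nonneg fun j _ =>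
        mul_nonneg (G.vertexWeight_nonneg i₀ j) ?_)
      exact schrodinger_inv_mulVec_nonneg _ ha (fun j => hη j) j
    · rw [h22Density_eq_igDensity, igDensity, if_neg ha]
      simp

variable {V : Type*} [Fintype V] [DecidableEq V]

theorem lintegral_h22Density (G : WeightedGraph V) {η : V → ℝ} (hη : ∀ i, 0 ≤ η i) :
    ∫⁻ β, ENNReal.ofReal (G.h22Density η β) = 1 :=
  lintegral_h22Density_aux _ rfl G hη

theorem isProbabilityMeasure_h22Law (G : WeightedGraph V) {η : V → ℝ} (hη : ∀ i, 0 ≤ η i) :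
    IsProbabilityMeasure (G.h22Law η) := by
  refine ⟨?_⟩
  rw [h22Law, withDensity_apply _ MeasurableSet.univ, setLIntegral_univ, G.lintegral_h22Density hη]

theorem h22Density_nonneg (G : WeightedGraph V) (η β : V → ℝ) : 0 ≤ G.h22Density η β := by
  rw [h22Density_eq_igDensity]
  exact igDensity_nonneg _ _

theorem h22Density_of_not_posDef (G : WeightedGraph V) (η : V → ℝ) {β : V → ℝ}
    (h : ¬ (G.schrodinger β).PosDef) : G.h22Density η β = 0 := by
  rw [h22Density_eq_igDensity, igDensity, if_neg h]

theorem lintegral_h22Law (G : WeightedGraph V) (η : V → ℝ) {f : (V → ℝ) → ENNReal}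
    (hf : Measurable f) :
    ∫⁻ β, f β ∂(G.h22Law η) = ∫⁻ β, ENNReal.ofReal (G.h22Density η β) * f β := by
  rw [h22Law, lintegral_withDensity_eq_lintegral_mul _ (G.measurable_h22Density η).ennreal_ofReal hf]
  rfl

theorem ae_posDef_h22Law (G : WeightedGraph V) (η : V → ℝ) :
    ∀ᵐ β ∂(G.h22Law η), (G.schrodinger β).PosDef := by
  rw [h22Law, ae_withDensity_iff (G.measurable_h22Density η).ennreal_ofReal]
  refine ae_of_all _ fun β h => ?_
  by_contra hn
  exact h (by rw [G.h22Density_of_not_posDef η hn, ENNReal.ofReal_zero])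

end Normalization

/-! ### The total mass of the inverse in terms of one pivot. -/

section Vertex

variable {V : Type*} [Fintype V] [DecidableEq V]

/-- The total mass of the inverse of the block of `H_β` on the complement of `i₀`. -/
noncomputable def vertexMass (G : WeightedGraph V) (i₀ : V) (a : {j // j ≠ i₀} → ℝ) : ℝ :=
  (1 : {j // j ≠ i₀} → ℝ) ⬝ᵥ (G.vertexInv i₀ a *ᵥ 1)

/-- The quantity `1 + ⟨w, A⁻¹ 1⟩`, with `A` the block of `H_β` on the complement of `i₀`, and
`w` the weights at `i₀`. -/
noncomputable def vertexLevel (G : WeightedGraph V) (i₀ : V) (a : {j // j ≠ i₀} → ℝ) : ℝ :=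
  1 + G.vertexWeight i₀ ⬝ᵥ (G.vertexInv i₀ a *ᵥ 1)

theorem vertexMass_nonneg (G : WeightedGraph V) (i₀ : V) {a : {j // j ≠ i₀} → ℝ}
    (ha : ((G.induce (· ≠ i₀)).schrodinger a).PosDef) : 0 ≤ G.vertexMass i₀ a :=
  Finset.sum_nonneg fun j _ => mul_nonneg zero_le_one
    (schrodinger_inv_mulVec_nonneg _ ha (fun _ => zero_le_one) j)

theorem one_le_vertexLevel (G : WeightedGraph V) (i₀ : V) {a : {j // j ≠ i₀} → ℝ}
    (ha : ((G.induce (· ≠ i₀)).schrodinger a).PosDef) : 1 ≤ G.vertexLevel i₀ a :=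
  le_add_of_nonneg_right <| Finset.sum_nonneg fun j _ => mul_nonneg (G.vertexWeight_nonneg i₀ j)
    (schrodinger_inv_mulVec_nonneg _ ha (fun _ => zero_le_one) j)

theorem inv_mulVec_one_comp_vertexEquiv (G : WeightedGraph V) (i₀ : V) {x : ℝ}
    {a : {j // j ≠ i₀} → ℝ} (h : (G.schrodinger (vertexPoint i₀ x a)).PosDef) :
    ((G.schrodinger (vertexPoint i₀ x a))⁻¹ *ᵥ 1) ∘ vertexEquiv i₀ =
      Sum.elim (G.vertexInv i₀ a *ᵥ
          (1 + (G.vertexLevel i₀ a / G.pivot i₀ x a) • G.vertexWeight i₀))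
        (fun _ => G.vertexLevel i₀ a / G.pivot i₀ x a) := by
  have hA := ((G.posDef_vertexPoint_iff i₀ x a).1 h).1
  have hp := ((G.posDef_vertexPoint_iff i₀ x a).1 h).2
  set M := G.schrodinger (vertexPoint i₀ x a)
  set A := (G.induce (· ≠ i₀)).schrodinger a with hAdef
  set C := replicateCol Unit (G.vertexWeight i₀) with hC
  have hSentry := G.schur_vertex_apply i₀ x a
  rw [← hC, ← hAdef] at hSentry
  set S : Matrix Unit Unit ℝ := (Matrix.of fun _ _ => 2 * x) - Cᵀ * A⁻¹ * C with hS
  have hS' : (Matrix.of fun _ _ => 2 * x) - (-C)ᵀ * A⁻¹ * (-C) = S := by simp [hS]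
  have hSu : IsUnit S := by
    rw [isUnit_iff_isUnit_det, det_unique, isUnit_iff_ne_zero]
    exact hSentry ▸ hp.ne'
  have h1 : (M⁻¹ *ᵥ 1) ∘ vertexEquiv i₀ =
      (M.submatrix (vertexEquiv i₀) (vertexEquiv i₀))⁻¹ *ᵥ Sum.elim 1 1 := by
    rw [inv_submatrix_equiv, submatrix_mulVec_equiv]
    congr 2
    ext i
    simp only [Function.comp, Pi.one_apply]
    cases (vertexEquiv i₀).symm i <;> rfl
  rw [h1, schrodinger_vertexPoint, ← hAdef, ← hC,
    Matrix.inv_fromBlocks_mulVec _ _ _ hA.isUnit (hS' ▸ hSu), hS']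
  have hz : S⁻¹ *ᵥ (1 - (-C)ᵀ *ᵥ (A⁻¹ *ᵥ 1)) = fun _ => G.vertexLevel i₀ a / G.pivot i₀ x a := by
    ext u
    have hinv : S⁻¹ u u = (G.pivot i₀ x a)⁻¹ := by
      rw [← hSentry]; exact inv_unique_apply S
    have hv : (1 - (-C)ᵀ *ᵥ (A⁻¹ *ᵥ 1) : Unit → ℝ) u = G.vertexLevel i₀ a := by
      rw [transpose_neg, neg_mulVec, sub_neg_eq_add]
      rfl
    rw [mulVec, dotProduct, Fintype.sum_unique]
    rw [show (default : Unit) = u from rfl, hinv, hv]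
    ring
  rw [hz]
  congr 2
  ext j
  simp [hC, mulVec, dotProduct]
  ring

theorem inv_mulVec_one_vertex (G : WeightedGraph V) (i₀ : V) {x : ℝ}
    {a : {j // j ≠ i₀} → ℝ} (h : (G.schrodinger (vertexPoint i₀ x a)).PosDef) :
    ((G.schrodinger (vertexPoint i₀ x a))⁻¹ *ᵥ 1) i₀ = G.vertexLevel i₀ a / G.pivot i₀ x a :=
  congrFun (G.inv_mulVec_one_comp_vertexEquiv i₀ h) (Sum.inr ())

/-- Since `x` enters only through the pivot, prescribing the total mass, and hence the reduced
potential, determines `x` from `a`. This is why level sets are graphs over `a`. -/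
theorem dotProduct_inv_mulVec_one (G : WeightedGraph V) (i₀ : V) {x : ℝ}
    {a : {j // j ≠ i₀} → ℝ} (h : (G.schrodinger (vertexPoint i₀ x a)).PosDef) :
    (1 : V → ℝ) ⬝ᵥ ((G.schrodinger (vertexPoint i₀ x a))⁻¹ *ᵥ 1) =
      G.vertexMass i₀ a + G.vertexLevel i₀ a ^ 2 / G.pivot i₀ x a := by
  have hA := ((G.posDef_vertexPoint_iff i₀ x a).1 h).1
  have hsymm : (G.vertexInv i₀ a)ᵀ = G.vertexInv i₀ a := by
    have := hA.inv.isHermitian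
    rwa [Matrix.IsHermitian, conjTranspose_eq_transpose_of_trivial] at this
  rw [← comp_equiv_dotProduct_comp_equiv _ _ (vertexEquiv i₀),
    G.inv_mulVec_one_comp_vertexEquiv i₀ h]
  have : (1 : V → ℝ) ∘ vertexEquiv i₀ = Sum.elim (1 : {j // j ≠ i₀} → ℝ) (1 : Unit → ℝ) := by
    ext (i | i) <;> rfl
  rw [this, sumElim_dotProduct_sumElim, mulVec_add, dotProduct_add, mulVec_smul, dotProduct_smul]
  have h2 : (1 : {j // j ≠ i₀} → ℝ) ⬝ᵥ (G.vertexInv i₀ a *ᵥ G.vertexWeight i₀)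
      = G.vertexLevel i₀ a - 1 := by
    rw [dotProduct_mulVec, ← mulVec_transpose, hsymm, dotProduct_comm, vertexLevel]
    ring
  rw [h2]
  simp [vertexMass]
  ring

theorem reducedPotential_eq (G : WeightedGraph V) (β : V → ℝ) :
    G.reducedPotential β =
      (Fintype.card V : ℝ) ^ 2 / (2 * ((1 : V → ℝ) ⬝ᵥ ((G.schrodinger β)⁻¹ *ᵥ 1))) := by
  simp [reducedPotential, dotProduct, mulVec]

theorem levelJacobian_eq (G : WeightedGraph V) (i₀ : V) (t : ℝ) (β : V → ℝ) :
    G.levelJacobian i₀ t β =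
      (2 * t / Fintype.card V * ((G.schrodinger β)⁻¹ *ᵥ 1) i₀) ^ 2 := by
  simp [levelJacobian, dotProduct, mulVec]

theorem levelPoint_eq_vertexPoint (G : WeightedGraph V) (i₀ : V) (t : ℝ)
    (a : {j // j ≠ i₀} → ℝ) :
    G.levelPoint i₀ t a = vertexPoint i₀ (G.levelCoord i₀ t a) a := rfl

/-- The value comes from solving `mass + level² / pivot = |V|² / (2 t)` for the pivot. -/
theorem pivot_levelCoord (G : WeightedGraph V) (i₀ : V) (t : ℝ) (a : {j // j ≠ i₀} → ℝ) :
    G.pivot i₀ (G.levelCoord i₀ t a) a =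
      G.vertexLevel i₀ a ^ 2 / ((Fintype.card V : ℝ) ^ 2 / (2 * t) - G.vertexMass i₀ a) := by
  have : 2 * G.levelCoord i₀ t a = G.vertexWeight i₀ ⬝ᵥ (G.vertexInv i₀ a *ᵥ G.vertexWeight i₀)
      + G.vertexLevel i₀ a ^ 2 / ((Fintype.card V : ℝ) ^ 2 / (2 * t) - G.vertexMass i₀ a) := by
    exact mul_div_cancel₀ (_ : ℝ) (two_ne_zero' ℝ)
  rw [pivot, this]
  ring

end Vertex

end WeightedGraph

/-! ### The coordinate at `i₀` as a function of the level `t`. -/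

section ChangeOfVariables

open Set

variable {p l k N : ℝ}

/-- Here `p`, `l`, `k`, `N` stand for the vertex mass, the vertex level, `⟨w, A⁻¹ w⟩` and `|V|`. The
derivative is kept as the inverse of a square because that square is `levelJacobian`, with `l` over
the pivot in place of the row sum of the inverse at `i₀`. -/
theorem hasDerivAt_levelCoord_aux {t : ℝ} (ht : 0 < t)
    (hr : p < N ^ 2 / (2 * t)) :
    HasDerivAt (fun t => (k + l ^ 2 / (N ^ 2 / (2 * t) - p)) / 2)
      ((2 * t / N * (l / (l ^ 2 / (N ^ 2 / (2 * t) - p)))) ^ 2)⁻¹ t := by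
  have h1 : HasDerivAt (fun t : ℝ => N ^ 2 / (2 * t)) (-(N ^ 2 / (2 * t ^ 2))) t := by
    have := (hasDerivAt_const t (N ^ 2)).div ((hasDerivAt_id t).const_mul 2)
      (by simpa using ht.ne')
    refine this.congr_deriv ?_
    simp only [id]
    field_simp
    ring
  have hd : N ^ 2 / (2 * t) - p ≠ 0 := (sub_pos.2 hr).ne'
  have h2 := (((hasDerivAt_const t (l ^ 2)).div (h1.sub_const p) hd).const_add k).div_const 2
  refine h2.congr_deriv ?_
  set r := N ^ 2 / (2 * t) - p
  field_simp
  ring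

theorem image_levelCoord_aux (hp : 0 ≤ p) (hl : 0 < l) (hN : 0 < N) :
    (fun t => (k + l ^ 2 / (N ^ 2 / (2 * t) - p)) / 2) '' {t | 0 < t ∧ p < N ^ 2 / (2 * t)} =
      Ioi (k / 2) := by
  ext x
  constructor
  · rintro ⟨t, ⟨ht, hr⟩, rfl⟩
    have : 0 < l ^ 2 / (N ^ 2 / (2 * t) - p) := div_pos (pow_pos hl 2) (sub_pos.2 hr)
    simp only [mem_Ioi]
    linarith
  · intro hx
    simp only [mem_Ioi] at hx
    have hs : 0 < 2 * x - k := by linarith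
    have hq : 0 < l ^ 2 / (2 * x - k) := by positivity
    have hpq : 0 < p + l ^ 2 / (2 * x - k) := by linarith
    have hr : N ^ 2 / (2 * (N ^ 2 / (2 * (p + l ^ 2 / (2 * x - k))))) =
        p + l ^ 2 / (2 * x - k) := by
      field_simp
    -- The level of the point with coordinate `x`: `p + l² / (2 x - k)` is its total mass.
    refine ⟨N ^ 2 / (2 * (p + l ^ 2 / (2 * x - k))), ⟨by positivity, ?_⟩, ?_⟩
    · rw [hr]; linarith
    · simp only
      rw [hr, add_sub_cancel_left, div_div_cancel₀ (pow_pos hl 2).ne']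
      ring

theorem injOn_levelCoord_aux (hl : 0 < l) (hN : 0 < N) :
    InjOn (fun t => (k + l ^ 2 / (N ^ 2 / (2 * t) - p)) / 2)
      {t | 0 < t ∧ p < N ^ 2 / (2 * t)} := by
  rintro s ⟨hs, hrs⟩ t ⟨ht, hrt⟩ h
  have hl2 : (l ^ 2 : ℝ) ≠ 0 := (pow_pos hl 2).ne'
  have h1 : l ^ 2 / (N ^ 2 / (2 * s) - p) = l ^ 2 / (N ^ 2 / (2 * t) - p) := by
    simp only at h; linarith
  have h2 : N ^ 2 / (2 * s) = N ^ 2 / (2 * t) := by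
    have h3 := inv_injective (mul_left_cancel₀ hl2 h1)
    linarith
  have h4 := inv_injective (mul_left_cancel₀ (pow_pos hN 2).ne' h2)
  linarith

theorem measurableSet_chart (p N : ℝ) : MeasurableSet {t : ℝ | 0 < t ∧ p < N ^ 2 / (2 * t)} := by
  have h : Measurable fun t : ℝ => N ^ 2 / (2 * t) := by fun_prop
  exact (measurableSet_lt measurable_const measurable_id).inter
    (measurableSet_lt measurable_const h)

theorem setLIntegral_congr_of_subset {α : Type*} [MeasurableSpace α] {μ : Measure α} {s t : Set α}
    (hs : MeasurableSet s) (ht : MeasurableSet t) (hst : s ⊆ t) {f : α → ENNReal}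
    (hf : ∀ x ∈ t, x ∉ s → f x = 0) : ∫⁻ x in s, f x ∂μ = ∫⁻ x in t, f x ∂μ := by
  rw [← inter_eq_self_of_subset_left hst, ← setLIntegral_indicator hs]
  refine setLIntegral_congr_fun ht fun x hx => ?_
  by_cases hxs : x ∈ s
  · rw [indicator_of_mem hxs]
  · rw [indicator_of_notMem hxs, hf x hx hxs]

theorem lintegral_levelCoord_aux (hp : 0 ≤ p) (hl : 0 < l) (hN : 0 < N) (f : ℝ → ENNReal) :
    ∫⁻ x in Ioi (k / 2), f x =
      ∫⁻ t in {t | 0 < t ∧ p < N ^ 2 / (2 * t)},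
        ENNReal.ofReal (((2 * t / N * (l / (l ^ 2 / (N ^ 2 / (2 * t) - p)))) ^ 2)⁻¹) *
          f ((k + l ^ 2 / (N ^ 2 / (2 * t) - p)) / 2) := by
  have hm := measurableSet_chart p N
  rw [← image_levelCoord_aux hp hl hN, lintegral_image_eq_lintegral_abs_deriv_mul hm
    (fun t ht => (hasDerivAt_levelCoord_aux ht.1 ht.2).hasDerivWithinAt)
    (injOn_levelCoord_aux hl hN)]
  refine setLIntegral_congr_fun hm fun t _ => ?_
  rw [abs_of_nonneg (by positivity)]

end ChangeOfVariables

/-! ### Disintegration over the level sets of the reduced potential. -/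

namespace WeightedGraph

variable {V : Type*} [Fintype V] [DecidableEq V]

open Set

section Measurability

theorem measurable_vertexMass (G : WeightedGraph V) (i₀ : V) : Measurable (G.vertexMass i₀) :=
  (G.induce (· ≠ i₀)).measurable_dotProduct_schrodinger_inv _ _

theorem measurable_vertexLevel (G : WeightedGraph V) (i₀ : V) : Measurable (G.vertexLevel i₀) :=
  ((G.induce (· ≠ i₀)).measurable_dotProduct_schrodinger_inv _ _).const_add 1

theorem measurable_levelCoord (G : WeightedGraph V) (i₀ : V) :
    Measurable fun q : ℝ × ({j // j ≠ i₀} → ℝ) => G.levelCoord i₀ q.1 q.2 := by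
  have hs : Measurable fun q : ℝ × ({j // j ≠ i₀} → ℝ) => q.2 := measurable_snd
  have h1 := ((G.induce (· ≠ i₀)).measurable_dotProduct_schrodinger_inv
    (G.vertexWeight i₀) (G.vertexWeight i₀)).comp hs
  have h2 := (G.measurable_vertexLevel i₀).comp hs
  have h3 := (G.measurable_vertexMass i₀).comp hs
  have h4 : Measurable fun q : ℝ × ({j // j ≠ i₀} → ℝ) => (Fintype.card V : ℝ) ^ 2 / (2 * q.1) := by
    fun_prop
  exact (h1.add ((h2.pow_const 2).div (h4.sub h3))).div_const 2

theorem measurable_levelPoint (G : WeightedGraph V) (i₀ : V) :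
    Measurable fun q : ℝ × ({j // j ≠ i₀} → ℝ) => G.levelPoint i₀ q.1 q.2 :=
  (measurable_vertexPoint i₀).comp ((G.measurable_levelCoord i₀).prodMk measurable_snd)

theorem measurable_levelJacobian (G : WeightedGraph V) (i₀ : V) :
    Measurable fun q : ℝ × (V → ℝ) => G.levelJacobian i₀ q.1 q.2 := by
  have h : Measurable fun q : ℝ × (V → ℝ) => ∑ j, (G.schrodinger q.2)⁻¹ i₀ j :=
    Finset.measurable_sum _ fun j _ => (G.measurable_schrodinger_inv i₀ j).comp measurable_snd
  have h2 : Measurable fun q : ℝ × (V → ℝ) => 2 * q.1 / Fintype.card V := by fun_prop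
  exact (h2.mul h).pow_const 2

/-- The density of `levelMeasure` in the chart. -/
noncomputable def chartDensity (G : WeightedGraph V) (η : V → ℝ) (i₀ : V) (t : ℝ)
    (a : {j // j ≠ i₀} → ℝ) : ℝ :=
  G.h22Density η (G.levelPoint i₀ t a) / G.levelJacobian i₀ t (G.levelPoint i₀ t a)

theorem measurable_chartDensity (G : WeightedGraph V) (η : V → ℝ) (i₀ : V) :
    Measurable fun q : ℝ × ({j // j ≠ i₀} → ℝ) => G.chartDensity η i₀ q.1 q.2 :=
  ((G.measurable_h22Density η).comp (G.measurable_levelPoint i₀)).div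
    ((G.measurable_levelJacobian i₀).comp (measurable_fst.prodMk (G.measurable_levelPoint i₀)))

theorem lintegral_levelMeasure (G : WeightedGraph V) (η : V → ℝ) (i₀ : V) (t : ℝ)
    {f : (V → ℝ) → ENNReal} (hf : Measurable f) :
    ∫⁻ b, f b ∂(G.levelMeasure η i₀ t) =
      ∫⁻ a, ENNReal.ofReal (G.chartDensity η i₀ t a) * f (G.levelPoint i₀ t a) := by
  have hlp : Measurable (G.levelPoint i₀ t) := (G.measurable_levelPoint i₀).of_uncurry_left
  have hd : Measurable fun a => ENNReal.ofReal (G.chartDensity η i₀ t a) :=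
    ((G.measurable_chartDensity η i₀).of_uncurry_left).ennreal_ofReal
  rw [levelMeasure, lintegral_map hf hlp]
  exact lintegral_withDensity_eq_lintegral_mul _ hd (hf.comp hlp)

theorem measurable_levelMeasure (G : WeightedGraph V) (η : V → ℝ) (i₀ : V) :
    Measurable (G.levelMeasure η i₀) := by
  refine Measure.measurable_of_measurable_coe _ fun s hs => ?_
  have h : ∀ t, G.levelMeasure η i₀ t s = ∫⁻ a, ENNReal.ofReal (G.chartDensity η i₀ t a) *
      s.indicator 1 (G.levelPoint i₀ t a) := fun t => by
    rw [← G.lintegral_levelMeasure η i₀ t (measurable_one.indicator hs), lintegral_indicator_one hs]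
  simp_rw [h]
  exact Measurable.lintegral_prod_right' (f := fun q : ℝ × ({j // j ≠ i₀} → ℝ) =>
    ENNReal.ofReal (G.chartDensity η i₀ q.1 q.2) * s.indicator 1 (G.levelPoint i₀ q.1 q.2))
    ((G.measurable_chartDensity η i₀).ennreal_ofReal.mul
      ((measurable_one.indicator hs).comp (G.measurable_levelPoint i₀)))

end Measurability

section Level

/-- The pivot at the level point has the sign of `|V|² / (2 t) - mass`, because the vertex level is
at least one. -/
theorem posDef_levelPoint_iff (G : WeightedGraph V) (i₀ : V) (t : ℝ) (a : {j // j ≠ i₀} → ℝ) :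
    (G.schrodinger (G.levelPoint i₀ t a)).PosDef ↔
      ((G.induce (· ≠ i₀)).schrodinger a).PosDef ∧
        G.vertexMass i₀ a < (Fintype.card V : ℝ) ^ 2 / (2 * t) := by
  rw [levelPoint_eq_vertexPoint, posDef_vertexPoint_iff, pivot_levelCoord]
  refine and_congr_right fun ha => ?_
  have hl : 0 < G.vertexLevel i₀ a := zero_lt_one.trans_le (G.one_le_vertexLevel i₀ ha)
  rw [div_pos_iff_of_pos_left (pow_pos hl 2), sub_pos]

theorem reducedPotential_levelPoint (G : WeightedGraph V) (i₀ : V) {t : ℝ}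
    {a : {j // j ≠ i₀} → ℝ} (h : (G.schrodinger (G.levelPoint i₀ t a)).PosDef) :
    G.reducedPotential (G.levelPoint i₀ t a) = t := by
  have hN : (Fintype.card V : ℝ) ≠ 0 := by
    have : Nonempty V := ⟨i₀⟩
    exact_mod_cast Fintype.card_ne_zero
  obtain ⟨ha, hr⟩ := (G.posDef_levelPoint_iff i₀ t a).1 h
  have hl : 0 < G.vertexLevel i₀ a := zero_lt_one.trans_le (G.one_le_vertexLevel i₀ ha)
  rw [levelPoint_eq_vertexPoint] at h ⊢
  rw [reducedPotential_eq, G.dotProduct_inv_mulVec_one i₀ h, pivot_levelCoord,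
    div_div_cancel₀ (pow_pos hl 2).ne', add_sub_cancel]
  -- At `t = 0` the quotient `|V|² / (2 t)` is zero by convention, which a nonnegative mass cannot
  -- lie below.
  have ht : t ≠ 0 := by
    rintro rfl
    have := G.vertexMass_nonneg i₀ ha
    simp at hr
    linarith
  field_simp

theorem levelJacobian_levelPoint (G : WeightedGraph V) (i₀ : V) {t : ℝ}
    {a : {j // j ≠ i₀} → ℝ} (h : (G.schrodinger (G.levelPoint i₀ t a)).PosDef) :
    G.levelJacobian i₀ t (G.levelPoint i₀ t a) =
      (2 * t / Fintype.card V * (G.vertexLevel i₀ a / (G.vertexLevel i₀ a ^ 2 /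
        ((Fintype.card V : ℝ) ^ 2 / (2 * t) - G.vertexMass i₀ a)))) ^ 2 := by
  rw [levelPoint_eq_vertexPoint] at h ⊢
  rw [levelJacobian_eq, G.inv_mulVec_one_vertex i₀ h, pivot_levelCoord]

/-- The disintegration of the law of the potential over the level sets of the reduced
potential. -/
theorem lintegral_h22Law_eq_lintegral_levelMeasure (G : WeightedGraph V) (η : V → ℝ) (i₀ : V)
    {f : ℝ × (V → ℝ) → ENNReal} (hf : Measurable f) :
    ∫⁻ β, f (G.reducedPotential β, β) ∂(G.h22Law η) =
      ∫⁻ t in Ioi (0 : ℝ), ∫⁻ b, f (t, b) ∂(G.levelMeasure η i₀ t) := by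
  have hN : (0 : ℝ) < Fintype.card V := by
    have : Nonempty V := ⟨i₀⟩
    exact_mod_cast Fintype.card_pos
  have hF := G.measurable_reducedPotential
  have hd := (G.measurable_h22Density η).ennreal_ofReal
  have hfF : Measurable fun β => f (G.reducedPotential β, β) := hf.comp (hF.prodMk measurable_id)
  -- Tonelli brings `a` outside, leaving a one-dimensional comparison for each fixed `a`.
  have hR : ∫⁻ t in Ioi (0 : ℝ), ∫⁻ b, f (t, b) ∂(G.levelMeasure η i₀ t) =
      ∫⁻ a, ∫⁻ t in Ioi (0 : ℝ), ENNReal.ofReal (G.chartDensity η i₀ t a) *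
        f (t, G.levelPoint i₀ t a) := by
    have h1 (t : ℝ) := G.lintegral_levelMeasure η i₀ t
      (hf.comp (measurable_prodMk_left (x := t)))
    simp only [Function.comp_def] at h1
    simp_rw [h1]
    refine lintegral_lintegral_swap (Measurable.aemeasurable ?_)
    exact (G.measurable_chartDensity η i₀).ennreal_ofReal.mul
      (hf.comp (measurable_fst.prodMk (G.measurable_levelPoint i₀)))
  rw [hR, G.lintegral_h22Law η hfF]
  refine (lintegral_vertex i₀ (hd.mul hfF)).trans ?_
  refine lintegral_congr fun a => ?_
  by_cases ha : ((G.induce (· ≠ i₀)).schrodinger a).PosDef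
  swap
  · have h1 : ∀ x, G.h22Density η (vertexPoint i₀ x a) = 0 := fun x =>
      G.h22Density_of_not_posDef η fun h => ha ((G.posDef_vertexPoint_iff i₀ x a).1 h).1
    simp only [chartDensity, levelPoint_eq_vertexPoint, Pi.mul_apply, h1, ENNReal.ofReal_zero,
      zero_mul, zero_div, lintegral_zero]
  have hl : 0 < G.vertexLevel i₀ a := zero_lt_one.trans_le (G.one_le_vertexLevel i₀ ha)
  set k := G.vertexWeight i₀ ⬝ᵥ (G.vertexInv i₀ a *ᵥ G.vertexWeight i₀) with hk
  set T := {t : ℝ | 0 < t ∧ G.vertexMass i₀ a < (Fintype.card V : ℝ) ^ 2 / (2 * t)} with hT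
  have hTm : MeasurableSet T := measurableSet_chart _ _
  have hTsub : T ⊆ Ioi 0 := fun t ht => ht.1
  calc ∫⁻ x, ENNReal.ofReal (G.h22Density η (vertexPoint i₀ x a)) *
        f (G.reducedPotential (vertexPoint i₀ x a), vertexPoint i₀ x a)
      = ∫⁻ x in Ioi (k / 2), ENNReal.ofReal (G.h22Density η (vertexPoint i₀ x a)) *
        f (G.reducedPotential (vertexPoint i₀ x a), vertexPoint i₀ x a) := by
        refine (setLIntegral_eq_of_support_subset fun x hx => ?_).symm
        have hx' : (G.schrodinger (vertexPoint i₀ x a)).PosDef := by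
          by_contra hn
          refine hx ?_
          simp only
          rw [G.h22Density_of_not_posDef η hn, ENNReal.ofReal_zero, zero_mul]
        have := ((G.posDef_vertexPoint_iff i₀ x a).1 hx').2
        rw [pivot, ← hk] at this
        rw [mem_Ioi]
        linarith
    _ = ∫⁻ t in T, ENNReal.ofReal (G.chartDensity η i₀ t a) * f (t, G.levelPoint i₀ t a) := by
        -- Substituting `t` for `x` brings in the inverse Jacobian by which `chartDensity` is
        -- defined.
        rw [lintegral_levelCoord_aux (G.vertexMass_nonneg i₀ ha) hl hN]
        refine setLIntegral_congr_fun hTm fun t ht => ?_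
        have hpos : (G.schrodinger (G.levelPoint i₀ t a)).PosDef :=
          (G.posDef_levelPoint_iff i₀ t a).2 ⟨ha, ht.2⟩
        have hx : vertexPoint i₀ ((k + G.vertexLevel i₀ a ^ 2 /
            ((Fintype.card V : ℝ) ^ 2 / (2 * t) - G.vertexMass i₀ a)) / 2) a =
            G.levelPoint i₀ t a := rfl
        rw [hx, G.reducedPotential_levelPoint i₀ hpos, chartDensity,
          G.levelJacobian_levelPoint i₀ hpos, ← mul_assoc,
          ← ENNReal.ofReal_mul (by positivity), inv_mul_eq_div]
    _ = ∫⁻ t in Ioi (0 : ℝ), ENNReal.ofReal (G.chartDensity η i₀ t a) *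
          f (t, G.levelPoint i₀ t a) := by
        refine setLIntegral_congr_of_subset hTm measurableSet_Ioi hTsub fun t ht htT => ?_
        rw [chartDensity, G.h22Density_of_not_posDef η, zero_div, ENNReal.ofReal_zero, zero_mul]
        exact fun h => htT ⟨ht, ((G.posDef_levelPoint_iff i₀ t a).1 h).2⟩

end Level

end WeightedGraph

/-! ### Uniqueness of a measure given its Laplace transform in `1 / t` at the natural numbers. -/

section Uniqueness

open Set BoundedContinuousFunction

/-- Finite measures on a Polish space agree if an injective bounded continuous function has the
same moments. -/
theorem MeasureTheory.Measure.ext_of_forall_integral_pow_eq {E : Type*} [TopologicalSpace E]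
    [PolishSpace E] [MeasurableSpace E] [BorelSpace E] {μ ν : Measure E} [IsFiniteMeasure μ]
    [IsFiniteMeasure ν] (f : E →ᵇ ℝ) (hf : Function.Injective f)
    (h : ∀ k : ℕ, ∫ x, f x ^ k ∂μ = ∫ x, f x ^ k ∂ν) : μ = ν := by
  refine ext_of_forall_mem_subalgebra_integral_eq_of_polish (𝕜 := ℝ)
    (A := StarAlgebra.adjoin ℝ {f}) ?_ ?_
  · intro x y hxy
    refine ⟨f, ?_, fun h => hxy (hf h)⟩
    exact ⟨_, ⟨f, StarAlgebra.self_mem_adjoin_singleton ℝ f, rfl⟩, rfl⟩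
  · intro g hg
    have hg' : g ∈ Algebra.adjoin ℝ {f} := by
      have := StarAlgebra.adjoin_toSubalgebra ℝ ({f} : Set (E →ᵇ ℝ))
      have hg2 : g ∈ (StarAlgebra.adjoin ℝ ({f} : Set (E →ᵇ ℝ))).toSubalgebra := hg
      rw [this] at hg2
      -- Over the reals the star is trivial, so the star subalgebra consists of the polynomials in
      -- `f`, whose integrals are combinations of moments.
      have hs : star ({f} : Set (E →ᵇ ℝ)) = {f} := by
        rw [Set.star_singleton, show star f = f from BoundedContinuousFunction.ext fun x => rfl]
      rwa [hs, union_self] at hg2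
    rw [Algebra.adjoin_singleton_eq_range_aeval] at hg'
    obtain ⟨p, rfl⟩ := hg'
    have hp : ∀ x, (Polynomial.aeval f p : E →ᵇ ℝ) x =
        ∑ k ∈ Finset.range (p.natDegree + 1), p.coeff k * f x ^ k := by
      intro x
      rw [Polynomial.aeval_eq_sum_range]
      simp [BoundedContinuousFunction.coe_sum]
    have hint : ∀ (ρ : Measure E) [IsFiniteMeasure ρ] (k : ℕ), Integrable (fun x => f x ^ k) ρ :=
      fun ρ _ k => (f ^ k).integrable ρ
    have key : ∀ (ρ : Measure E) [IsFiniteMeasure ρ], ∫ x, (Polynomial.aeval f p : E →ᵇ ℝ) x ∂ρ =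
        ∑ k ∈ Finset.range (p.natDegree + 1), p.coeff k * ∫ x, f x ^ k ∂ρ := by
      intro ρ _
      simp_rw [hp]
      rw [integral_finsetSum _ fun k _ => (hint ρ k).const_mul _]
      simp_rw [integral_const_mul]
    exact (key μ).trans ((Finset.sum_congr rfl fun k _ => by rw [h k]).trans (key ν).symm)

/-- A finite measure on `(0, ∞)` is determined by the integrals of `exp (- k / t)`. -/
theorem ae_eq_of_forall_lintegral_exp_neg_div {u v : ℝ → ENNReal} (hu : Measurable u)
    (hv : Measurable v) (hfin : ∫⁻ t in Ioi (0 : ℝ), u t ≠ ⊤)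
    (h : ∀ k : ℕ, ∫⁻ t in Ioi (0 : ℝ), ENNReal.ofReal (Real.exp (-(k / t))) * u t =
      ∫⁻ t in Ioi (0 : ℝ), ENNReal.ofReal (Real.exp (-(k / t))) * v t) :
    u =ᵐ[volume.restrict (Ioi 0)] v := by
  have hfin' : ∫⁻ t in Ioi (0 : ℝ), v t ≠ ⊤ := by
    have := h 0
    simp only [Nat.cast_zero, zero_div, neg_zero, Real.exp_zero, ENNReal.ofReal_one, one_mul] at this
    rwa [← this]
  rw [← withDensity_eq_iff hu.aemeasurable hv.aemeasurable hfin]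
  set μ := (volume.restrict (Ioi (0 : ℝ))).withDensity u with hμ
  set ν := (volume.restrict (Ioi (0 : ℝ))).withDensity v with hν
  have : IsFiniteMeasure μ := isFiniteMeasure_withDensity hfin
  have : IsFiniteMeasure ν := isFiniteMeasure_withDensity hfin'
  have hpos : ∀ᵐ t ∂(volume.restrict (Ioi (0 : ℝ))), 0 < t := ae_restrict_mem measurableSet_Ioi
  have hexp : ∀ ρ : Measure ℝ, ρ ≪ volume.restrict (Ioi (0 : ℝ)) →
      (ρ.map Real.log).map Real.exp = ρ := by
    intro ρ hρ
    rw [Measure.map_map Real.measurable_exp Real.measurable_log]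
    conv_rhs => rw [← Measure.map_id (μ := ρ)]
    refine Measure.map_congr ?_
    filter_upwards [hρ.ae_le hpos] with t ht
    exact Real.exp_log ht
  rw [← hexp μ (withDensity_absolutelyContinuous _ _), ← hexp ν (withDensity_absolutelyContinuous _ _)]
  congr 1
  -- In the variable `y = log t` this is `exp (-1 / t)`, whose powers are the given test functions;
  -- the logarithm makes it continuous and injective on the whole line.
  let f : ℝ →ᵇ ℝ := BoundedContinuousFunction.ofNormedAddCommGroup
    (fun y => Real.exp (-Real.exp (-y))) (by fun_prop) 1 (fun y => by
      rw [Real.norm_eq_abs, Real.abs_exp, Real.exp_le_one_iff]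
      exact neg_nonpos.2 (Real.exp_pos _).le)
  have hfa : ∀ y, f y = Real.exp (-Real.exp (-y)) := fun y => rfl
  refine Measure.ext_of_forall_integral_pow_eq f ?_ ?_
  · intro x y hxy
    rw [hfa, hfa, Real.exp_eq_exp, neg_inj, Real.exp_eq_exp, neg_inj] at hxy
    exact hxy
  · intro k
    have hk : ∀ (ρ : Measure ℝ), ∫ y, f y ^ k ∂(ρ.map Real.log) =
        (∫⁻ t, ENNReal.ofReal (f (Real.log t) ^ k) ∂ρ).toReal := by
      intro ρ
      have hm : Measurable fun y => f y ^ k := (f.continuous.measurable).pow_const k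
      rw [integral_map Real.measurable_log.aemeasurable hm.aestronglyMeasurable,
        integral_eq_lintegral_of_nonneg_ae]
      · exact ae_of_all _ fun t => pow_nonneg (hfa _ ▸ (Real.exp_pos _).le) k
      · exact (hm.comp Real.measurable_log).aestronglyMeasurable
    have hw : ∀ w : ℝ → ENNReal, Measurable w →
        ∫⁻ t, ENNReal.ofReal (f (Real.log t) ^ k) ∂(volume.restrict (Ioi (0 : ℝ))).withDensity w =
        ∫⁻ t in Ioi (0 : ℝ), ENNReal.ofReal (Real.exp (-(k / t))) * w t := by
      intro w hw
      have hm : Measurable fun t => ENNReal.ofReal (f (Real.log t) ^ k) :=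
        (((f.continuous.measurable).comp Real.measurable_log).pow_const k).ennreal_ofReal
      rw [lintegral_withDensity_eq_lintegral_mul _ hw hm]
      refine setLIntegral_congr_fun measurableSet_Ioi fun t ht => ?_
      simp only [Pi.mul_apply, mul_comm (w t)]
      rw [hfa, Real.exp_neg (Real.log t), Real.exp_log ht, ← Real.exp_nat_mul]
      congr 3
      ring
    rw [hk, hk, hμ, hν, hw u hu, hw v hv, h k]

end Uniqueness

/-! ### A bounded continuous profile for the mass of a level set. -/

section Psi

/-- The function `σ ^ (3 / 2) * exp (- σ / 2)` of `u = 1 / σ`, extended by `0` to `u ≤ 0`. -/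
noncomputable def invGaussianProfile (u : ℝ) : ℝ :=
  if 0 < u then u⁻¹ * √(u⁻¹) * Real.exp (-(u⁻¹ / 2)) else 0

theorem invGaussianProfile_nonneg (u : ℝ) : 0 ≤ invGaussianProfile u := by
  unfold invGaussianProfile
  split_ifs <;> positivity

/-- With `σ = 1 / u`, the bound `exp (σ / 2) ≥ σ² / 8` suffices. Its purpose is continuity at `u =
0`, the edge of the positive definite region. -/
theorem invGaussianProfile_le_sqrt (u : ℝ) : invGaussianProfile u ≤ 8 * √u := by
  unfold invGaussianProfile
  split_ifs with hu
  · have hx : 0 < u⁻¹ := inv_pos.2 hu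
    have hexp : (u⁻¹) ^ 2 / 8 ≤ Real.exp (u⁻¹ / 2) := by
      have := Real.quadratic_le_exp_of_nonneg (x := u⁻¹ / 2) (by positivity)
      nlinarith
    rw [Real.exp_neg, ← div_eq_mul_inv, div_le_iff₀ (Real.exp_pos _)]
    have h1 : u⁻¹ * √(u⁻¹) = 8 * √u * (u⁻¹ ^ 2 / 8) := by
      rw [Real.sqrt_inv]
      have := Real.mul_self_sqrt hu.le
      have hs : √u ≠ 0 := (Real.sqrt_pos.2 hu).ne'
      field_simp
      nlinarith
    rw [h1]
    exact mul_le_mul_of_nonneg_left hexp (by positivity)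
  · positivity

theorem invGaussianProfile_le (u : ℝ) : invGaussianProfile u ≤ 8 := by
  rcases le_total u 1 with h | h
  · refine (invGaussianProfile_le_sqrt u).trans ?_
    have : √u ≤ 1 := Real.sqrt_le_one.2 h
    linarith
  · unfold invGaussianProfile
    rw [if_pos (by linarith)]
    have h0 : u⁻¹ ≤ 1 := inv_le_one_of_one_le₀ h
    have h1 : √(u⁻¹) ≤ 1 := Real.sqrt_le_one.2 h0
    have hp : 0 < u⁻¹ := inv_pos.2 (by linarith)
    have h2 : Real.exp (-(u⁻¹ / 2)) ≤ 1 := Real.exp_le_one_iff.2 (by linarith)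
    have h3 : u⁻¹ * √(u⁻¹) ≤ 1 := mul_le_one₀ h0 (Real.sqrt_nonneg _) h1
    have h4 := mul_le_one₀ h3 (Real.exp_pos _).le h2
    linarith

theorem continuous_invGaussianProfile : Continuous invGaussianProfile := by
  rw [continuous_iff_continuousAt]
  intro u
  rcases lt_trichotomy u 0 with hu | rfl | hu
  · refine (continuousAt_const (y := (0 : ℝ))).congr ?_
    filter_upwards [gt_mem_nhds hu] with x hx
    rw [invGaussianProfile, if_neg (not_lt.2 hx.le)]
  · have h0 : invGaussianProfile 0 = 0 := by simp [invGaussianProfile]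
    rw [ContinuousAt, h0]
    refine squeeze_zero invGaussianProfile_nonneg invGaussianProfile_le_sqrt ?_
    have : Continuous fun u : ℝ => 8 * √u := by fun_prop
    simpa using this.tendsto 0
  · have h : ContinuousAt (fun u : ℝ => u⁻¹ * √(u⁻¹) * Real.exp (-(u⁻¹ / 2))) u := by
      have hi : ContinuousAt (fun u : ℝ => u⁻¹) u := continuousAt_inv₀ hu.ne'
      exact (hi.mul hi.sqrt).mul (hi.div_const 2).neg.rexp
    refine h.congr ?_
    filter_upwards [lt_mem_nhds hu] with x hx
    rw [invGaussianProfile, if_pos hx]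

end Psi

/-! ### Dependence of the one-vertex density on the boundary value. -/

section ScalarDensityBoundary

theorem scalarDensity_eq_exp_mul (y : ℝ) {s : ℝ} (hs : 0 < s) :
    scalarDensity s y = Real.exp (-(1 / 2) * (y ^ 2 / s - 2 * y)) * scalarDensity s 0 := by
  unfold scalarDensity
  rw [if_pos hs, if_pos hs, mul_div_assoc', mul_left_comm, ← Real.exp_add]
  congr 3
  ring

theorem scalarDensity_pos (y : ℝ) {s : ℝ} (hs : 0 < s) : 0 < scalarDensity s y := by
  unfold scalarDensity
  rw [if_pos hs]
  have := Real.pi_pos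
  positivity

theorem scalarDensity_of_nonpos (y : ℝ) {s : ℝ} (hs : s ≤ 0) : scalarDensity s y = 0 :=
  if_neg (not_lt.2 hs)

theorem continuousOn_scalarDensity (y : ℝ) :
    ContinuousOn (fun s => scalarDensity s y) (Set.Ioi 0) := by
  have : ContinuousOn (fun s => √(2 / Real.pi) *
      Real.exp (-(1 / 2) * (s + y ^ 2 / s - 2 * y)) / √s) (Set.Ioi 0) := by
    refine ContinuousOn.div ?_ (by fun_prop) fun s hs => (Real.sqrt_pos.2 hs).ne'
    refine continuousOn_const.mul (ContinuousOn.rexp (continuousOn_const.mul ?_))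
    exact (continuousOn_id.add (continuousOn_const.div continuousOn_id
      fun s hs => ne_of_gt hs)).sub continuousOn_const
  exact this.congr fun s hs => if_pos hs

end ScalarDensityBoundary

/-! ### The law of the reduced potential. -/

namespace WeightedGraph

theorem card_pos_of_vertex {V : Type*} [Fintype V] (i₀ : V) : (0 : ℝ) < Fintype.card V := by
  have : Nonempty V := ⟨i₀⟩
  exact_mod_cast Fintype.card_pos

variable {V : Type*} [Fintype V] [DecidableEq V]

open Set

theorem h22Density_const (G : WeightedGraph V) (c : ℝ) {β : V → ℝ}
    (h : (G.schrodinger β).PosDef) :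
    G.h22Density (fun _ => c) β =
      Real.exp (-(1 / 2) * (c ^ 2 * ((1 : V → ℝ) ⬝ᵥ ((G.schrodinger β)⁻¹ *ᵥ 1))
        - 2 * (c * Fintype.card V))) * G.h22Density 0 β := by
  have hc : (fun _ => c : V → ℝ) = c • 1 := by ext; simp
  rw [h22Density_eq_igDensity, h22Density_eq_igDensity, igDensity, igDensity, if_pos h, if_pos h,
    hc, mulVec_smul, smul_dotProduct, dotProduct_smul, dotProduct_smul, mul_div_assoc',
    mul_left_comm, ← Real.exp_add]
  congr 3
  simp
  ring

theorem dotProduct_inv_mulVec_one_levelPoint (G : WeightedGraph V) (i₀ : V) {t : ℝ}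
    {a : {j // j ≠ i₀} → ℝ} (h : (G.schrodinger (G.levelPoint i₀ t a)).PosDef) :
    (1 : V → ℝ) ⬝ᵥ ((G.schrodinger (G.levelPoint i₀ t a))⁻¹ *ᵥ 1) =
      (Fintype.card V : ℝ) ^ 2 / (2 * t) := by
  obtain ⟨ha, hr⟩ := (G.posDef_levelPoint_iff i₀ t a).1 h
  have hl : 0 < G.vertexLevel i₀ a := zero_lt_one.trans_le (G.one_le_vertexLevel i₀ ha)
  rw [levelPoint_eq_vertexPoint] at h ⊢
  rw [G.dotProduct_inv_mulVec_one i₀ h, pivot_levelCoord, div_div_cancel₀ (pow_pos hl 2).ne',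
    add_sub_cancel]

/-- A constant boundary interacts with `H_β` only through the total mass of its inverse, which is
`|V|² / (2 t)` on the whole level set. The factor is the one by which a boundary `θ` tilts the
one-vertex density. -/
theorem chartDensity_const (G : WeightedGraph V) (θ : ℝ) (i₀ : V) (t : ℝ)
    (a : {j // j ≠ i₀} → ℝ) :
    G.chartDensity (fun _ => θ / Fintype.card V) i₀ t a =
      Real.exp (-(1 / 2) * (θ ^ 2 / (2 * t) - 2 * θ)) * G.chartDensity 0 i₀ t a := by
  unfold chartDensity
  by_cases h : (G.schrodinger (G.levelPoint i₀ t a)).PosDef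
  · have hN := card_pos_of_vertex i₀
    rw [G.h22Density_const _ h, G.dotProduct_inv_mulVec_one_levelPoint i₀ h, mul_div_assoc]
    congr 4
    · field_simp
    · field_simp
  · rw [G.h22Density_of_not_posDef _ h, G.h22Density_of_not_posDef _ h]
    simp

theorem levelMeasure_univ_eq (G : WeightedGraph V) (η : V → ℝ) (i₀ : V) (t : ℝ) :
    G.levelMeasure η i₀ t univ = ∫⁻ a, ENNReal.ofReal (G.chartDensity η i₀ t a) := by
  have := G.lintegral_levelMeasure η i₀ t (f := 1) measurable_one
  simpa using this

theorem levelMeasure_const_univ (G : WeightedGraph V) (θ : ℝ) (i₀ : V) (t : ℝ) :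
    G.levelMeasure (fun _ => θ / Fintype.card V) i₀ t univ =
      ENNReal.ofReal (Real.exp (-(1 / 2) * (θ ^ 2 / (2 * t) - 2 * θ))) *
        G.levelMeasure 0 i₀ t univ := by
  rw [levelMeasure_univ_eq, levelMeasure_univ_eq, ← lintegral_const_mul' _ _ ENNReal.ofReal_ne_top]
  simp_rw [chartDensity_const, ENNReal.ofReal_mul (Real.exp_pos _).le]

theorem lintegral_levelMeasure_univ (G : WeightedGraph V) {η : V → ℝ} (hη : ∀ i, 0 ≤ η i)
    (i₀ : V) : ∫⁻ t in Ioi (0 : ℝ), G.levelMeasure η i₀ t univ = 1 := by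
  have := G.isProbabilityMeasure_h22Law hη
  have h := G.lintegral_h22Law_eq_lintegral_levelMeasure η i₀ (f := 1) measurable_one
  simpa using h.symm

theorem _root_.lintegral_scalarDensity_Ioi {y : ℝ} (hy : 0 ≤ y) :
    ∫⁻ t in Ioi (0 : ℝ), ENNReal.ofReal (scalarDensity (2 * t) y) = 1 := by
  have h := lintegral_scalarDensity 0 hy
  simp only [sub_zero] at h
  rw [← h]
  refine setLIntegral_eq_of_support_subset fun t ht => ?_
  by_contra hn
  refine ht ?_
  simp only
  rw [scalarDensity_of_nonpos _ (by simp only [mem_Ioi, not_lt] at hn; linarith),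
    ENNReal.ofReal_zero]

/-- For each `θ ≥ 0`, tilting either side by `exp (θ - θ² / (4 t))` gives a function of integral
one. Hence all the required Laplace integrals agree, without computing the mass of any level set. -/
theorem ae_levelMeasure_zero_univ (G : WeightedGraph V) (i₀ : V) :
    (fun t => G.levelMeasure 0 i₀ t univ) =ᵐ[volume.restrict (Ioi 0)]
      fun t => ENNReal.ofReal (scalarDensity (2 * t) 0) := by
  have hN := card_pos_of_vertex i₀
  have hm : Measurable fun t => G.levelMeasure 0 i₀ t univ :=
    (Measure.measurable_coe MeasurableSet.univ).comp (G.measurable_levelMeasure 0 i₀)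
  have hg : Measurable fun t : ℝ => ENNReal.ofReal (scalarDensity (2 * t) 0) :=
    (measurable_scalarDensity.comp
      ((measurable_id.const_mul 2).prodMk measurable_const)).ennreal_ofReal
  refine ae_eq_of_forall_lintegral_exp_neg_div hm hg ?_ fun k => ?_
  · rw [G.lintegral_levelMeasure_univ (η := 0) (fun _ => le_rfl) i₀]
    exact ENNReal.one_ne_top
  -- Chosen so that `θ² / (4 t) = k / t`.
  · set θ : ℝ := 2 * √k with hθ
    have hθ0 : 0 ≤ θ := by positivity
    have hexp : ∀ t : ℝ, Real.exp (-(1 / 2) * (θ ^ 2 / (2 * t) - 2 * θ)) =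
        Real.exp θ * Real.exp (-(k / t)) := by
      intro t
      rw [← Real.exp_add, hθ, mul_pow, Real.sq_sqrt (Nat.cast_nonneg k)]
      congr 1
      ring
    have h1 := G.lintegral_levelMeasure_univ (η := fun _ => θ / Fintype.card V)
      (fun _ => by positivity) i₀
    have h2 := lintegral_scalarDensity_Ioi hθ0
    have h2' : ∫⁻ t in Ioi (0 : ℝ), ENNReal.ofReal (scalarDensity (2 * t) θ) =
        ∫⁻ t in Ioi (0 : ℝ), ENNReal.ofReal (Real.exp θ) *
          (ENNReal.ofReal (Real.exp (-(k / t))) * ENNReal.ofReal (scalarDensity (2 * t) 0)) := by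
      refine setLIntegral_congr_fun measurableSet_Ioi fun t ht => ?_
      rw [scalarDensity_eq_exp_mul θ (mul_pos two_pos ht), hexp, mul_assoc,
        ENNReal.ofReal_mul (Real.exp_pos _).le, ENNReal.ofReal_mul (Real.exp_pos _).le]
    simp_rw [levelMeasure_const_univ, hexp, ENNReal.ofReal_mul (Real.exp_pos _).le, mul_assoc] at h1
    rw [h2', lintegral_const_mul' _ _ ENNReal.ofReal_ne_top] at h2
    rw [lintegral_const_mul' _ _ ENNReal.ofReal_ne_top, ← h2] at h1
    exact (ENNReal.mul_right_inj (by simp [Real.exp_pos]) ENNReal.ofReal_ne_top).1 h1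

/-- The total mass of the level set, up to an explicit factor, as a function of the total mass
`r` of the inverse of `H_β`. -/
noncomputable def levelMass (G : WeightedGraph V) (i₀ : V) (r : ℝ) : ℝ :=
  ∫ a : {j // j ≠ i₀} → ℝ, (G.induce (· ≠ i₀)).h22Density (G.vertexWeight i₀) a *
    ((G.vertexLevel i₀ a ^ 2)⁻¹ *
      invGaussianProfile ((r - G.vertexMass i₀ a) / G.vertexLevel i₀ a ^ 2))

theorem integrable_h22Density (G : WeightedGraph V) {η : V → ℝ} (hη : ∀ i, 0 ≤ η i) :
    Integrable (G.h22Density η) := by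
  refine ⟨(G.measurable_h22Density η).aestronglyMeasurable, ?_⟩
  rw [hasFiniteIntegral_iff_ofReal (ae_of_all _ (G.h22Density_nonneg η)),
    G.lintegral_h22Density hη]
  exact ENNReal.one_lt_top

theorem levelMass_integrand_le (G : WeightedGraph V) (i₀ : V) (r : ℝ) (a : {j // j ≠ i₀} → ℝ) :
    ‖(G.induce (· ≠ i₀)).h22Density (G.vertexWeight i₀) a *
      ((G.vertexLevel i₀ a ^ 2)⁻¹ *
        invGaussianProfile ((r - G.vertexMass i₀ a) / G.vertexLevel i₀ a ^ 2))‖ ≤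
      (G.induce (· ≠ i₀)).h22Density (G.vertexWeight i₀) a * 8 := by
  have hd := (G.induce (· ≠ i₀)).h22Density_nonneg (G.vertexWeight i₀) a
  have hψ := invGaussianProfile_nonneg ((r - G.vertexMass i₀ a) / G.vertexLevel i₀ a ^ 2)
  rw [Real.norm_of_nonneg (by positivity)]
  by_cases ha : ((G.induce (· ≠ i₀)).schrodinger a).PosDef
  · refine mul_le_mul_of_nonneg_left ?_ hd
    have h1 : (G.vertexLevel i₀ a ^ 2)⁻¹ ≤ 1 :=
      inv_le_one_of_one_le₀ (one_le_pow₀ (G.one_le_vertexLevel i₀ ha))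
    exact (mul_le_of_le_one_left hψ h1).trans (invGaussianProfile_le _)
  · rw [h22Density_of_not_posDef _ _ ha]
    simp

theorem measurable_levelMass_integrand (G : WeightedGraph V) (i₀ : V) (r : ℝ) :
    Measurable fun a : {j // j ≠ i₀} → ℝ =>
      (G.induce (· ≠ i₀)).h22Density (G.vertexWeight i₀) a *
        ((G.vertexLevel i₀ a ^ 2)⁻¹ *
          invGaussianProfile ((r - G.vertexMass i₀ a) / G.vertexLevel i₀ a ^ 2)) := by
  have hl := (G.measurable_vertexLevel i₀).pow_const 2
  exact ((G.induce (· ≠ i₀)).measurable_h22Density _).mul (hl.inv.mul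
    (continuous_invGaussianProfile.measurable.comp
      (((G.measurable_vertexMass i₀).const_sub r).div hl)))

/-- Dominated convergence: the vertex level is at least one and the profile at most eight, so a
multiple of the inverse Gaussian density dominates. The constraint `mass < r` is absorbed into the
continuous profile. -/
theorem continuous_levelMass (G : WeightedGraph V) (i₀ : V) : Continuous (G.levelMass i₀) := by
  refine continuous_of_dominated
    (fun r => (G.measurable_levelMass_integrand i₀ r).aestronglyMeasurable)
    (fun r => ae_of_all _ (G.levelMass_integrand_le i₀ r))
    (((G.induce (· ≠ i₀)).integrable_h22Density (G.vertexWeight_nonneg i₀)).mul_const 8)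
    (ae_of_all _ fun a => ?_)
  have := continuous_invGaussianProfile
  fun_prop

/-- For pivot `σ` and vertex level `l`, the one-vertex factor is `√(2 / π) σ ^ (-1 / 2) exp (-σ /
2)` and the Jacobian is `(2 t l / (|V| σ))²`; the quotient contains `σ ^ (3 / 2) exp (-σ / 2)`, the
profile at `u = 1 / σ`. -/
theorem chartDensity_zero_eq (G : WeightedGraph V) (i₀ : V) {t : ℝ} (ht : 0 < t)
    (a : {j // j ≠ i₀} → ℝ) :
    G.chartDensity 0 i₀ t a =
      √(2 / Real.pi) * ((Fintype.card V : ℝ) ^ 2 / (4 * t ^ 2)) *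
      ((G.induce (· ≠ i₀)).h22Density (G.vertexWeight i₀) a *
        ((G.vertexLevel i₀ a ^ 2)⁻¹ * invGaussianProfile
          (((Fintype.card V : ℝ) ^ 2 / (2 * t) - G.vertexMass i₀ a) / G.vertexLevel i₀ a ^ 2))) := by
  have hN := card_pos_of_vertex i₀
  by_cases ha : ((G.induce (· ≠ i₀)).schrodinger a).PosDef
  swap
  · rw [chartDensity, h22Density_of_not_posDef _ _ ha, h22Density_of_not_posDef, zero_div, zero_mul,
      mul_zero]
    exact fun h => ha ((G.posDef_levelPoint_iff i₀ t a).1 h).1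
  have hl : 0 < G.vertexLevel i₀ a := zero_lt_one.trans_le (G.one_le_vertexLevel i₀ ha)
  by_cases hr : G.vertexMass i₀ a < (Fintype.card V : ℝ) ^ 2 / (2 * t)
  swap
  · rw [chartDensity, invGaussianProfile, if_neg, h22Density_of_not_posDef, zero_div, mul_zero,
      mul_zero, mul_zero]
    · exact fun h => hr ((G.posDef_levelPoint_iff i₀ t a).1 h).2
    · rw [div_pos_iff_of_pos_right (pow_pos hl 2), sub_pos]
      exact hr
  have hpos := (G.posDef_levelPoint_iff i₀ t a).2 ⟨ha, hr⟩
  rw [chartDensity, G.levelJacobian_levelPoint i₀ hpos, levelPoint_eq_vertexPoint,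
    h22Density_vertexPoint, pivot_levelCoord]
  have hz : (fun j : {j // j ≠ i₀} => (0 : V → ℝ) j) = 0 := rfl
  rw [hz, zero_add, mulVec_zero, dotProduct_zero, Pi.zero_apply, add_zero]
  set r := (Fintype.card V : ℝ) ^ 2 / (2 * t) - G.vertexMass i₀ a with hrdef
  have hr0 : 0 < r := sub_pos.2 hr
  set l := G.vertexLevel i₀ a
  have hu : 0 < r / l ^ 2 := by positivity
  have hinv : l ^ 2 / r = (r / l ^ 2)⁻¹ := (inv_div _ _).symm
  rw [scalarDensity, if_pos (by positivity), invGaussianProfile, if_pos hu, hinv]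
  have hlu : l / (r / l ^ 2)⁻¹ = (r / l ^ 2) * l := by field_simp
  rw [hlu]
  set u := r / l ^ 2
  have hs : √(u⁻¹) ≠ 0 := (Real.sqrt_pos.2 (inv_pos.2 hu)).ne'
  have hs2 : √(u⁻¹) ^ 2 = u⁻¹ := Real.sq_sqrt (inv_pos.2 hu).le
  have hexp : Real.exp (-(1 / 2) * (u⁻¹ + 0 ^ 2 / u⁻¹ - 2 * 0)) = Real.exp (-(u⁻¹ / 2)) := by
    congr 1; ring
  rw [hexp]
  set s := √(u⁻¹)
  have hu' : u = (s ^ 2)⁻¹ := by rw [hs2, inv_inv]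
  clear_value s
  generalize Real.exp (-(u⁻¹ / 2)) = E
  rw [hu']
  field_simp
  ring

theorem levelMeasure_zero_univ_eq (G : WeightedGraph V) (i₀ : V) {t : ℝ} (ht : 0 < t) :
    G.levelMeasure 0 i₀ t univ = ENNReal.ofReal (√(2 / Real.pi) *
      ((Fintype.card V : ℝ) ^ 2 / (4 * t ^ 2)) *
        G.levelMass i₀ ((Fintype.card V : ℝ) ^ 2 / (2 * t))) := by
  rw [levelMeasure_univ_eq]
  simp_rw [G.chartDensity_zero_eq i₀ ht]
  have hc : 0 ≤ √(2 / Real.pi) * ((Fintype.card V : ℝ) ^ 2 / (4 * t ^ 2)) := by positivity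
  rw [ENNReal.ofReal_mul hc]
  simp_rw [ENNReal.ofReal_mul hc]
  rw [lintegral_const_mul' _ _ ENNReal.ofReal_ne_top, levelMass, ofReal_integral_eq_lintegral_ofReal]
  · exact (((G.induce (· ≠ i₀)).integrable_h22Density (G.vertexWeight_nonneg i₀)).mul_const 8).mono'
      (G.measurable_levelMass_integrand i₀ _).aestronglyMeasurable
      (ae_of_all _ (G.levelMass_integrand_le i₀ _))
  · refine ae_of_all _ fun a => mul_nonneg (h22Density_nonneg _ _ _) (mul_nonneg (by positivity)
      (invGaussianProfile_nonneg _))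

theorem levelMass_nonneg (G : WeightedGraph V) (i₀ : V) (r : ℝ) : 0 ≤ G.levelMass i₀ r :=
  integral_nonneg fun _ => mul_nonneg (h22Density_nonneg _ _ _) (mul_nonneg (by positivity)
      (invGaussianProfile_nonneg _))

/-- The total mass of the level set `t`: the reduced potential has the one-vertex law. -/
theorem levelMeasure_univ (G : WeightedGraph V) (θ : ℝ) (i₀ : V) {t : ℝ} (ht : 0 < t) :
    G.levelMeasure (fun _ => θ / Fintype.card V) i₀ t univ =
      ENNReal.ofReal (scalarDensity (2 * t) θ) := by
  have hN := card_pos_of_vertex i₀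
  have key : EqOn (fun t => √(2 / Real.pi) * ((Fintype.card V : ℝ) ^ 2 / (4 * t ^ 2)) *
      G.levelMass i₀ ((Fintype.card V : ℝ) ^ 2 / (2 * t)))
      (fun t => scalarDensity (2 * t) 0) (Ioi 0) := by
    -- Continuous functions that agree almost everywhere on an open set agree on all of it.
    refine Measure.eqOn_open_of_ae_eq (μ := volume) ?_ isOpen_Ioi ?_ ?_
    · filter_upwards [G.ae_levelMeasure_zero_univ i₀, ae_restrict_mem measurableSet_Ioi] with t h ht
      rw [G.levelMeasure_zero_univ_eq i₀ ht] at h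
      have hm := G.levelMass_nonneg i₀ ((Fintype.card V : ℝ) ^ 2 / (2 * t))
      exact (ENNReal.ofReal_eq_ofReal_iff (by positivity) (scalarDensity_nonneg _ _)).1 h
    · refine (continuousOn_const.mul (continuousOn_const.div (by fun_prop) fun t ht => ?_)).mul
        ((G.continuous_levelMass i₀).comp_continuousOn
          (continuousOn_const.div (by fun_prop) fun t ht => ?_))
      · exact (mul_pos four_pos (pow_pos ht 2)).ne'
      · exact (mul_pos two_pos ht).ne'
    · exact (continuousOn_scalarDensity 0).comp (by fun_prop) fun t ht => mem_Ioi.2 (mul_pos two_pos ht)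
  rw [levelMeasure_const_univ, G.levelMeasure_zero_univ_eq i₀ ht,
    scalarDensity_eq_exp_mul θ (mul_pos two_pos ht), ENNReal.ofReal_mul (Real.exp_pos _).le]
  congr 2
  exact key ht

end WeightedGraph

/-! ### Rank-one cross blocks. -/

section VecMulVec

variable {ι κ : Type*} [Fintype ι]

/-- With identical rows, `B` averages `M` over both indices: only its total mass survives. This is
the algebraic content of indistinguishability. -/
theorem transpose_mul_mul_of_eq_vecMulVec {B : Matrix ι κ ℝ} {v : κ → ℝ} (hB : B = vecMulVec 1 v)
    (M : Matrix ι ι ℝ) : Bᵀ * M * B = ((1 : ι → ℝ) ⬝ᵥ (M *ᵥ 1)) • vecMulVec v v := by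
  rw [hB, transpose_vecMulVec, vecMulVec_mul, vecMulVec_mul_vecMulVec, vecMulVec_smul,
    dotProduct_mulVec]

theorem transpose_mulVec_mulVec_const_of_eq_vecMulVec {B : Matrix ι κ ℝ} {v : κ → ℝ}
    (hB : B = vecMulVec 1 v) (M : Matrix ι ι ℝ) (c : ℝ) :
    Bᵀ *ᵥ (M *ᵥ fun _ => c) = (c * ((1 : ι → ℝ) ⬝ᵥ (M *ᵥ 1))) • v := by
  have hc : (fun _ => c : ι → ℝ) = c • 1 := by ext; simp
  rw [hc, mulVec_smul, mulVec_smul, hB, transpose_vecMulVec, vecMulVec_mulVec, op_smul_eq_smul,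
    smul_smul]

end VecMulVec

/-! ### The conditional law given the reduced potential. -/

namespace WeightedGraph

section LevelKernel

variable {V : Type*} [Fintype V] [DecidableEq V]

open Set

theorem measurable_levelLaw (G : WeightedGraph V) (η : V → ℝ) (i₀ : V) :
    Measurable (G.levelLaw η i₀) := by
  have h := G.measurable_levelMeasure η i₀
  refine Measure.measurable_of_measurable_coe _ fun s hs => ?_
  exact (((Measure.measurable_coe MeasurableSet.univ).comp h).inv).mul
    ((Measure.measurable_coe hs).comp h)

open Classical in
/-- The law of the potential conditioned on the reduced potential. -/
noncomputable def levelKernel (G : WeightedGraph V) (η : V → ℝ) (i₀ : V) :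
    Kernel ℝ (V → ℝ) where
  -- Any probability measure would do for `t ≤ 0`: the reduced potential is positive whenever `H_β >
  -- 0`.
  toFun t := if 0 < t then G.levelLaw η i₀ t else Measure.dirac 0
  measurable' := Measurable.ite measurableSet_Ioi (G.measurable_levelLaw η i₀) measurable_const

theorem levelKernel_of_pos (G : WeightedGraph V) (η : V → ℝ) (i₀ : V) {t : ℝ} (ht : 0 < t) :
    G.levelKernel η i₀ t = G.levelLaw η i₀ t :=
  if_pos ht

variable (θ : ℝ)

theorem levelMeasure_univ_ne_zero (G : WeightedGraph V) (i₀ : V) {t : ℝ} (ht : 0 < t) :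
    G.levelMeasure (fun _ => θ / Fintype.card V) i₀ t univ ≠ 0 := by
  rw [G.levelMeasure_univ θ i₀ ht]
  simpa using scalarDensity_pos θ (mul_pos two_pos ht)

theorem levelMeasure_univ_ne_top (G : WeightedGraph V) (i₀ : V) {t : ℝ} (ht : 0 < t) :
    G.levelMeasure (fun _ => θ / Fintype.card V) i₀ t univ ≠ ⊤ := by
  rw [G.levelMeasure_univ θ i₀ ht]
  exact ENNReal.ofReal_ne_top

/-- Normalization is possible at every `t > 0`, not just almost every one, because the mass of the
level set is known pointwise and is positive and finite. -/
instance isMarkovKernel_levelKernel (G : WeightedGraph V) (i₀ : V) :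
    IsMarkovKernel (G.levelKernel (fun _ => θ / Fintype.card V) i₀) := by
  refine ⟨fun t => ?_⟩
  by_cases ht : 0 < t
  · rw [levelKernel_of_pos _ _ _ ht]
    refine ⟨?_⟩
    rw [levelLaw, Measure.smul_apply, smul_eq_mul]
    exact ENNReal.inv_mul_cancel (G.levelMeasure_univ_ne_zero θ i₀ ht)
      (G.levelMeasure_univ_ne_top θ i₀ ht)
  · have : G.levelKernel (fun _ => θ / Fintype.card V) i₀ t = Measure.dirac 0 := if_neg ht
    rw [this]
    infer_instance

theorem levelMeasure_eq_smul (G : WeightedGraph V) (i₀ : V) {t : ℝ} (ht : 0 < t) :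
    G.levelMeasure (fun _ => θ / Fintype.card V) i₀ t =
      ENNReal.ofReal (scalarDensity (2 * t) θ) •
        G.levelKernel (fun _ => θ / Fintype.card V) i₀ t := by
  rw [levelKernel_of_pos _ _ _ ht, levelLaw, smul_smul, ← G.levelMeasure_univ θ i₀ ht,
    ENNReal.mul_inv_cancel (G.levelMeasure_univ_ne_zero θ i₀ ht)
      (G.levelMeasure_univ_ne_top θ i₀ ht), one_smul]

theorem ae_levelMeasure (G : WeightedGraph V) (η : V → ℝ) (i₀ : V) (t : ℝ) :
    ∀ᵐ b ∂(G.levelMeasure η i₀ t), (G.schrodinger b).PosDef ∧ G.reducedPotential b = t := by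
  have hm : MeasurableSet {b : V → ℝ | (G.schrodinger b).PosDef ∧ G.reducedPotential b = t} :=
    G.measurableSet_posDef.inter (G.measurable_reducedPotential (measurableSet_singleton t))
  rw [ae_iff]
  change G.levelMeasure η i₀ t
    {b : V → ℝ | (G.schrodinger b).PosDef ∧ G.reducedPotential b = t}ᶜ = 0
  rw [← lintegral_indicator_one hm.compl,
    G.lintegral_levelMeasure η i₀ t (measurable_one.indicator hm.compl), ← lintegral_zero]
  refine lintegral_congr fun a => ?_
  by_cases h : (G.schrodinger (G.levelPoint i₀ t a)).PosDef
  · rw [indicator_of_notMem, mul_zero]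
    exact fun hn => hn ⟨h, G.reducedPotential_levelPoint i₀ h⟩
  · rw [chartDensity, G.h22Density_of_not_posDef η h, zero_div, ENNReal.ofReal_zero, zero_mul]

theorem ae_levelKernel (G : WeightedGraph V) (η : V → ℝ) (i₀ : V) {t : ℝ} (ht : 0 < t) :
    ∀ᵐ b ∂(G.levelKernel η i₀ t), (G.schrodinger b).PosDef ∧ G.reducedPotential b = t := by
  rw [levelKernel_of_pos _ _ _ ht, levelLaw]
  exact Measure.ae_smul_measure (G.ae_levelMeasure η i₀ t) _

theorem lintegral_h22Law_eq_lintegral_levelKernel (G : WeightedGraph V) (i₀ : V)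
    {f : ℝ × (V → ℝ) → ENNReal} (hf : Measurable f) :
    ∫⁻ β, f (G.reducedPotential β, β) ∂(G.h22Law (fun _ => θ / Fintype.card V)) =
      ∫⁻ t in Ioi (0 : ℝ), ENNReal.ofReal (scalarDensity (2 * t) θ) *
        ∫⁻ b, f (t, b) ∂(G.levelKernel (fun _ => θ / Fintype.card V) i₀ t) := by
  rw [G.lintegral_h22Law_eq_lintegral_levelMeasure _ i₀ hf]
  refine setLIntegral_congr_fun measurableSet_Ioi fun t ht => ?_
  rw [G.levelMeasure_eq_smul θ i₀ ht, lintegral_smul_measure, smul_eq_mul]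

variable {θ}

/-- `levelKernel` is a regular conditional law of the potential given the reduced potential. -/
theorem h22Law_map_eq_compProd_levelKernel (G : WeightedGraph V) (hθ : 0 ≤ θ) (i₀ : V) :
    (G.h22Law (fun _ => θ / Fintype.card V)).map (fun b => (G.reducedPotential b, b)) =
      (G.h22Law (fun _ => θ / Fintype.card V)).map G.reducedPotential ⊗ₘ
        G.levelKernel (fun _ => θ / Fintype.card V) i₀ := by
  have hF := G.measurable_reducedPotential
  have := G.isProbabilityMeasure_h22Law (η := fun _ => θ / Fintype.card V)
    (fun _ => by positivity)
  refine Measure.ext_of_lintegral _ fun f hf => ?_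
  have hK : Measurable fun t => ∫⁻ b, f (t, b) ∂(G.levelKernel (fun _ => θ / Fintype.card V) i₀ t) :=
    hf.lintegral_kernel_prod_right'
  -- The same disintegration, applied to a function of `t` alone, supplies the law of the reduced
  -- potential.
  have hR := G.lintegral_h22Law_eq_lintegral_levelKernel θ i₀ (hK.comp measurable_fst)
  simp only [Function.comp_def] at hR
  have hFi : Measurable fun b => (G.reducedPotential b, b) := hF.prodMk measurable_id
  rw [lintegral_map hf hFi, Measure.lintegral_compProd hf,
    lintegral_map hK hF, G.lintegral_h22Law_eq_lintegral_levelKernel θ i₀ hf, hR]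
  simp

end LevelKernel

/-! ### Comparison of the original and the reduced graph. -/

section Reduce

variable {V : Type*} (U : Finset V)

/-- The potential on the reduced graph with value `t` at `u` and `o` off `u`. -/
def reducedPoint (t : ℝ) (o : {k // k ∉ U} → ℝ) : ReducedVertex U → ℝ
  | none => t
  | some k => o k

/-- The vertex `u` of the reduced graph split off from the rest. -/
def reducedEquiv : Unit ⊕ {k : V // k ∉ U} ≃ ReducedVertex U :=
  (Equiv.sumComm _ _).trans (Equiv.optionEquivSumPUnit _).symm

theorem reducedPoint_comp_reducedEquiv (t : ℝ) (o : {k // k ∉ U} → ℝ) :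
    reducedPoint U t o ∘ reducedEquiv U = Sum.elim (fun _ => t) o := by
  ext (i | k) <;> rfl

theorem sumElim_comp_reducedEquiv_symm (t : ℝ) (o : {k // k ∉ U} → ℝ) :
    Sum.elim (fun _ => t) o ∘ (reducedEquiv U).symm = reducedPoint U t o := by
  rw [← reducedPoint_comp_reducedEquiv, Function.comp_assoc, Equiv.self_comp_symm,
    Function.comp_id]

theorem measurable_reducedPoint :
    Measurable fun p : ℝ × ({k // k ∉ U} → ℝ) => reducedPoint U p.1 p.2 := by
  refine measurable_pi_lambda _ fun i => ?_
  cases i with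
  | none => exact measurable_fst
  | some k => exact (measurable_pi_apply k).comp measurable_snd

theorem Indistinguishable.sum_weight {U : Finset V} {G : WeightedGraph V} (hU : G.Indistinguishable U)
    {i k : V} (hi : i ∈ U) (hk : k ∉ U) : ∑ j ∈ U, G.weight k j = U.card * G.weight i k := by
  rw [Finset.sum_congr rfl fun j hj => hU j hj i hi k hk, Finset.sum_const, nsmul_eq_mul,
    G.symm k i]

variable [DecidableEq V]

/-- The potential on `V` with values `b` on `U` and `o` off `U`. -/
def gluePotential (b : {i // i ∈ U} → ℝ) (o : {k // k ∉ U} → ℝ) : V → ℝ :=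
  fun i => if h : i ∈ U then b ⟨i, h⟩ else o ⟨i, h⟩

theorem gluePotential_comp_sumCompl (b : {i // i ∈ U} → ℝ) (o : {k // k ∉ U} → ℝ) :
    gluePotential U b o ∘ Equiv.sumCompl (· ∈ U) = Sum.elim b o := by
  ext (i | k)
  · simp [gluePotential]
  · simp [gluePotential, k.2]

theorem sumElim_comp_sumCompl_symm (b : {i // i ∈ U} → ℝ) (o : {k // k ∉ U} → ℝ) :
    Sum.elim b o ∘ (Equiv.sumCompl (· ∈ U)).symm = gluePotential U b o := by
  rw [← gluePotential_comp_sumCompl, Function.comp_assoc, Equiv.self_comp_symm, Function.comp_id]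

theorem gluePotential_mem (b : {i // i ∈ U} → ℝ) (o : {k // k ∉ U} → ℝ) :
    (fun i : {i // i ∈ U} => gluePotential U b o i) = b := by
  ext i
  simp [gluePotential]

theorem gluePotential_notMem (b : {i // i ∈ U} → ℝ) (o : {k // k ∉ U} → ℝ) :
    (fun k : {k // k ∉ U} => gluePotential U b o k) = o := by
  ext k
  simp [gluePotential, k.2]

theorem coarsen_gluePotential (G : WeightedGraph V) (b : {i // i ∈ U} → ℝ)
    (o : {k // k ∉ U} → ℝ) :
    G.coarsen U (gluePotential U b o) =
      reducedPoint U ((G.induce (· ∈ U)).reducedPotential b) o := by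
  ext (_ | k)
  · simp only [coarsen, gluePotential_mem, reducedPoint]
  · exact congrFun (gluePotential_notMem U b o) k

theorem refine_coarsen (G : WeightedGraph V) (β : V → ℝ) :
    refine U (G.coarsen U β) (fun i => β i) = β := by
  ext i
  by_cases h : i ∈ U <;> simp [refine, coarsen, h]

/-- The weights between `U` and its complement. -/
def crossWeight (G : WeightedGraph V) : Matrix {i // i ∈ U} {k // k ∉ U} ℝ :=
  Matrix.of fun i k => G.weight i k

/-- The weights between `u` and the other vertices of the reduced graph. -/
def reducedCrossWeight (G : WeightedGraph V) : Matrix Unit {k // k ∉ U} ℝ :=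
  Matrix.of fun _ k => ∑ i ∈ U, G.weight k i

theorem schrodinger_gluePotential (G : WeightedGraph V) (b : {i // i ∈ U} → ℝ)
    (o : {k // k ∉ U} → ℝ) :
    (G.schrodinger (gluePotential U b o)).submatrix
        (Equiv.sumCompl (· ∈ U)) (Equiv.sumCompl (· ∈ U)) =
      fromBlocks ((G.induce (· ∈ U)).schrodinger b) (-G.crossWeight U) (-G.crossWeight U)ᵀ
        ((G.induce (· ∉ U)).schrodinger o) := by
  have hb := G.schrodinger_induce (· ∈ U) (gluePotential U b o)
  have ho := G.schrodinger_induce (· ∉ U) (gluePotential U b o)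
  rw [gluePotential_mem] at hb
  rw [gluePotential_notMem] at ho
  rw [hb, ho]
  ext (i | i) (j | j)
  · rfl
  · have hij : (i : V) ≠ j := fun h => j.2 (h ▸ i.2)
    simp [schrodinger_apply_ne _ _ hij, crossWeight]
  · have hij : (i : V) ≠ j := fun h => i.2 (h ▸ j.2)
    simp [schrodinger_apply_ne _ _ hij, crossWeight, G.symm i j]
  · rfl

theorem schrodinger_reducedPoint (G : WeightedGraph V) (t : ℝ) (o : {k // k ∉ U} → ℝ) :
    ((G.reduce U).schrodinger (reducedPoint U t o)).submatrix
        (reducedEquiv U) (reducedEquiv U) =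
      fromBlocks (Matrix.of fun _ _ => 2 * t) (-G.reducedCrossWeight U)
        (-G.reducedCrossWeight U)ᵀ ((G.induce (· ∉ U)).schrodinger o) := by
  ext (i | i) (j | j)
  · exact schrodinger_apply_self _ _ _
  · exact schrodinger_apply_ne _ _ (Option.some_ne_none j).symm
  · exact schrodinger_apply_ne _ _ (Option.some_ne_none i)
  · rcases eq_or_ne i j with rfl | h
    · exact (schrodinger_apply_self _ _ _).trans
        ((G.induce (· ∉ U)).schrodinger_apply_self o i).symm
    · exact ((G.reduce U).schrodinger_apply_ne (reducedPoint U t o) (i := some i) (j := some j)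
        fun h' => h (Option.some_injective _ h')).trans
        ((G.induce (· ∉ U)).schrodinger_apply_ne o h).symm

variable [Fintype V]

theorem lintegral_gluePotential {f : (V → ℝ) → ENNReal} (hf : Measurable f) :
    ∫⁻ β, f β = ∫⁻ o : {k // k ∉ U} → ℝ, ∫⁻ b : {i // i ∈ U} → ℝ, f (gluePotential U b o) := by
  rw [lintegral_pi_sum_swap (Equiv.sumCompl (· ∈ U)) hf]
  simp_rw [sumElim_comp_sumCompl_symm]

theorem lintegral_reducedPoint {f : (ReducedVertex U → ℝ) → ENNReal} (hf : Measurable f) :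
    ∫⁻ β, f β = ∫⁻ o : {k // k ∉ U} → ℝ, ∫⁻ t : ℝ, f (reducedPoint U t o) := by
  rw [lintegral_pi_sum_swap (reducedEquiv U) hf]
  refine lintegral_congr fun o => ?_
  rw [lintegral_pi_unit]
  · simp_rw [sumElim_comp_reducedEquiv_symm]
  · refine hf.comp (measurable_pi_lambda _ fun v => ?_)
    simp only [Function.comp]
    cases (reducedEquiv U).symm v with
    | inl u => exact measurable_pi_apply u
    | inr k => exact measurable_const

/-- The boundary condition that `u` feels in the reduced graph. -/
def reducedBoundary (G : WeightedGraph V) (η' : ReducedVertex U → ℝ) : ℝ :=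
  η' none + ∑ k : {k // k ∉ U}, ∑ i ∈ U, G.weight k i

theorem reducedBoundary_nonneg (G : WeightedGraph V) {η' : ReducedVertex U → ℝ}
    (hη' : ∀ k, 0 ≤ η' k) : 0 ≤ G.reducedBoundary U η' :=
  add_nonneg (hη' _) (Finset.sum_nonneg fun _ _ => Finset.sum_nonneg fun _ _ => G.nonneg _ _)

variable {U}

/-- The equal split of `η' u` and the equal outer weights together make the boundary felt by `U`
constant, the case in which the law of the reduced potential is known. -/
theorem Indistinguishable.add_crossWeight_mulVec_one {G : WeightedGraph V}
    (hU : G.Indistinguishable U) (η' : ReducedVertex U → ℝ) :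
    (fun i : {i // i ∈ U} => splitBoundary U η' i) + G.crossWeight U *ᵥ 1 =
      fun _ => G.reducedBoundary U η' / Fintype.card {i // i ∈ U} := by
  ext i
  have hc : (U.card : ℝ) ≠ 0 := by exact_mod_cast (Finset.card_pos.2 ⟨(i : V), i.2⟩).ne'
  simp only [Pi.add_apply, mulVec, dotProduct, crossWeight, of_apply, Pi.one_apply, mul_one,
    splitBoundary, i.2, dite_true, reducedBoundary, Fintype.card_coe]
  rw [add_div, Finset.sum_div]
  congr 1
  refine Finset.sum_congr rfl fun k _ => ?_
  rw [hU.sum_weight i.2 k.2, mul_div_cancel_left₀ _ hc]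

theorem innerBoundary_eq (G : WeightedGraph V) (η : V → ℝ) :
    G.innerBoundary U η = (fun i : {i // i ∈ U} => η i) + G.crossWeight U *ᵥ 1 := by
  ext i
  simp only [innerBoundary, Pi.add_apply, mulVec, dotProduct, crossWeight, of_apply, Pi.one_apply,
    mul_one]
  congr 1
  exact Finset.sum_subtype _ (fun k => Finset.mem_compl) _

theorem Indistinguishable.innerBoundary_splitBoundary {G : WeightedGraph V}
    (hU : G.Indistinguishable U) (η' : ReducedVertex U → ℝ) :
    G.innerBoundary U (splitBoundary U η') =
      fun _ => G.reducedBoundary U η' / Fintype.card {i // i ∈ U} := by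
  rw [innerBoundary_eq, hU.add_crossWeight_mulVec_one]

/-- The densities on the original and on the reduced graph have a common factor. -/
theorem Indistinguishable.scalarDensity_mul_h22Density {G : WeightedGraph V}
    (hU : G.Indistinguishable U) (hne : U.Nonempty) (η' : ReducedVertex U → ℝ)
    (b : {i // i ∈ U} → ℝ) (o : {k // k ∉ U} → ℝ) :
    scalarDensity (2 * (G.induce (· ∈ U)).reducedPotential b) (G.reducedBoundary U η') *
        G.h22Density (splitBoundary U η') (gluePotential U b o) =
      (G.induce (· ∈ U)).h22Density
          (fun _ => G.reducedBoundary U η' / Fintype.card {i // i ∈ U}) b *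
        (G.reduce U).h22Density η'
          (reducedPoint U ((G.induce (· ∈ U)).reducedPotential b) o) := by
  obtain ⟨i₀, hi₀⟩ := hne
  have hc : (U.card : ℝ) ≠ 0 := by exact_mod_cast (Finset.card_pos.2 ⟨i₀, hi₀⟩).ne'
  set F := (G.induce (· ∈ U)).reducedPotential b with hF
  set A := (G.induce (· ∈ U)).schrodinger b with hA
  set D := (G.induce (· ∉ U)).schrodinger o with hD
  set w : {k // k ∉ U} → ℝ := fun k => G.weight i₀ k with hw
  set m := (1 : {i // i ∈ U} → ℝ) ⬝ᵥ (A⁻¹ *ᵥ 1) with hm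
  have hFm : (2 * F)⁻¹ = m / (U.card : ℝ) ^ 2 := by
    rw [hF, reducedPotential_eq, ← hA, ← hm, Fintype.card_coe]
    rw [mul_div_assoc', mul_div_mul_left _ _ two_ne_zero, inv_div]
  -- Indistinguishability makes all rows equal to the one at `i₀`.
  have hB : G.crossWeight U = vecMulVec 1 w := by
    ext i k
    simp only [crossWeight, of_apply, vecMulVec_apply, Pi.one_apply, one_mul, hw]
    rw [G.symm i k, G.symm i₀ k]
    exact hU i i.2 i₀ hi₀ k k.2
  have hB' : G.reducedCrossWeight U = vecMulVec 1 ((U.card : ℝ) • w) := by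
    ext i k
    simp only [reducedCrossWeight, of_apply, vecMulVec_apply, Pi.one_apply, one_mul, hw,
      Pi.smul_apply, smul_eq_mul]
    exact hU.sum_weight hi₀ k.2
  have h1 : (1 : Unit → ℝ) ⬝ᵥ ((Matrix.of fun _ _ => 2 * F : Matrix Unit Unit ℝ)⁻¹ *ᵥ 1) =
      (2 * F)⁻¹ := by
    simp [mulVec, dotProduct]
  -- The reduced weights are `|U| w`, and `|U|² / (2 F) = m`: eliminating `U` or `u` subtracts the
  -- same matrix.
  have hS : D - (G.crossWeight U)ᵀ * A⁻¹ * G.crossWeight U =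
      D - (G.reducedCrossWeight U)ᵀ * (Matrix.of fun _ _ => 2 * F : Matrix Unit Unit ℝ)⁻¹ *
        G.reducedCrossWeight U := by
    rw [transpose_mul_mul_of_eq_vecMulVec hB, transpose_mul_mul_of_eq_vecMulVec hB', ← hm, h1, hFm,
      vecMulVec_smul, smul_vecMulVec, smul_smul, smul_smul]
    congr 2
    field_simp
  -- Both transported boundaries add `(η' u / |U|) m w`.
  have hy : (fun k : {k // k ∉ U} => splitBoundary U η' k) + (G.crossWeight U)ᵀ *ᵥ
        (A⁻¹ *ᵥ fun i : {i // i ∈ U} => splitBoundary U η' i) =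
      (fun k => η' (some k)) + (G.reducedCrossWeight U)ᵀ *ᵥ
        ((Matrix.of fun _ _ => 2 * F : Matrix Unit Unit ℝ)⁻¹ *ᵥ fun _ => η' none) := by
    have hU1 : (fun i : {i // i ∈ U} => splitBoundary U η' i) = fun _ => η' none / U.card := by
      ext i
      simp [splitBoundary, i.2]
    have hO1 : (fun k : {k // k ∉ U} => splitBoundary U η' k) = fun k => η' (some k) := by
      ext k
      simp [splitBoundary, k.2]
    rw [hU1, hO1, transpose_mulVec_mulVec_const_of_eq_vecMulVec hB,
      transpose_mulVec_mulVec_const_of_eq_vecMulVec hB', ← hm, h1, hFm, smul_smul]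
    congr 2
    field_simp
  have e1 : splitBoundary U η' ∘ Equiv.sumCompl (· ∈ U) =
      Sum.elim (fun i : {i // i ∈ U} => splitBoundary U η' i)
        (fun k : {k // k ∉ U} => splitBoundary U η' k) := by
    ext (i | k) <;> rfl
  have e2 : η' ∘ reducedEquiv U = Sum.elim (fun _ => η' none) (fun k => η' (some k)) := by
    ext (i | k) <;> rfl
  have hθ : ((fun _ => η' none) + G.reducedCrossWeight U *ᵥ 1 : Unit → ℝ) () =
      G.reducedBoundary U η' := by
    simp [reducedCrossWeight, reducedBoundary, mulVec, dotProduct]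
  rw [h22Density_eq_igDensity, ← igDensity_submatrix (Equiv.sumCompl (· ∈ U)),
    schrodinger_gluePotential, e1, igDensity_fromBlocks, hU.add_crossWeight_mulVec_one,
    h22Density_eq_igDensity, h22Density_eq_igDensity, ← igDensity_submatrix (reducedEquiv U),
    schrodinger_reducedPoint, e2, igDensity_fromBlocks, igDensity_unique (ι := Unit), ← hA, ← hD,
    hS, hy]
  rw [show (default : Unit) = () from rfl, hθ, of_apply]
  ring

end Reduce

end WeightedGraph

/-! ### Coarse-graining and fine-graining. -/

namespace WeightedGraph

section CoarseGraining

open Set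

variable {V : Type*} [DecidableEq V] {U : Finset V}

theorem measurable_coarsen (G : WeightedGraph V) : Measurable (G.coarsen U) := by
  refine measurable_pi_lambda _ fun i => ?_
  cases i with
  | none =>
    exact (G.induce (· ∈ U)).measurable_reducedPotential.comp
      (measurable_pi_lambda _ fun i => measurable_pi_apply _)
  | some k => exact measurable_pi_apply _

theorem measurable_refine :
    Measurable fun p : (ReducedVertex U → ℝ) × ({i // i ∈ U} → ℝ) => refine U p.1 p.2 := by
  refine measurable_pi_lambda _ fun i => ?_
  by_cases h : i ∈ U
  · simp only [refine, h, dite_true]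
    exact (measurable_pi_apply _).comp measurable_snd
  · simp only [refine, h, dite_false]
    exact (measurable_pi_apply _).comp measurable_fst

variable [Fintype V]

theorem reducedPotential_pos (G : WeightedGraph V) [Nonempty V] {β : V → ℝ}
    (h : (G.schrodinger β).PosDef) : 0 < G.reducedPotential β := by
  have hm := (posDef_iff_dotProduct_mulVec.1 h.inv).2 (x := 1) one_ne_zero
  rw [star_trivial] at hm
  have hN : (0 : ℝ) < Fintype.card V := by exact_mod_cast Fintype.card_pos
  rw [reducedPotential_eq]
  positivity

/-- Dividing by the one-vertex density is legitimate where `H_{U,U} > 0`, since the reduced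
potential is positive there; elsewhere both sides vanish. -/
theorem Indistinguishable.h22Density_gluePotential {G : WeightedGraph V}
    (hU : G.Indistinguishable U) (hne : U.Nonempty) (η' : ReducedVertex U → ℝ)
    (b : {i // i ∈ U} → ℝ) (o : {k // k ∉ U} → ℝ) :
    G.h22Density (splitBoundary U η') (gluePotential U b o) =
      (G.induce (· ∈ U)).h22Density
          (fun _ => G.reducedBoundary U η' / Fintype.card {i // i ∈ U}) b *
        ((G.reduce U).h22Density η'
            (reducedPoint U ((G.induce (· ∈ U)).reducedPotential b) o) /
          scalarDensity (2 * (G.induce (· ∈ U)).reducedPotential b)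
            (G.reducedBoundary U η')) := by
  by_cases hb : ((G.induce (· ∈ U)).schrodinger b).PosDef
  · have : Nonempty {i // i ∈ U} := hne.to_subtype
    have hF := (G.induce (· ∈ U)).reducedPotential_pos hb
    have hg := scalarDensity_pos (G.reducedBoundary U η') (mul_pos two_pos hF)
    rw [mul_div_assoc', eq_div_iff hg.ne', mul_comm,
      hU.scalarDensity_mul_h22Density hne η' b o]
  · rw [h22Density_of_not_posDef _ _ hb, zero_mul, h22Density_of_not_posDef]
    intro h
    refine hb ?_
    have h2 := G.schrodinger_induce (· ∈ U) (gluePotential U b o)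
    rw [gluePotential_mem] at h2
    rw [h2]
    exact h.submatrix Subtype.val_injective

/-- The joint law of the coarse-grained potential and the potential on `U`. -/
theorem Indistinguishable.h22Law_map_coarsen {G : WeightedGraph V}
    (hU : G.Indistinguishable U) {η' : ReducedVertex U → ℝ} (hη' : ∀ k, 0 ≤ η' k)
    (i₀ : {i // i ∈ U}) :
    (G.h22Law (splitBoundary U η')).map
        (fun β => (G.coarsen U β, fun i : {i // i ∈ U} => β i)) =
      ((G.reduce U).h22Law η') ⊗ₘ
        ((G.induce (· ∈ U)).levelKernel
          (fun _ => G.reducedBoundary U η' / Fintype.card {i // i ∈ U}) i₀).comap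
          (fun β' : ReducedVertex U → ℝ => β' none) (measurable_pi_apply none) := by
  set θ := G.reducedBoundary U η' with hθ
  set κ := (G.induce (· ∈ U)).levelKernel (fun _ => θ / Fintype.card {i // i ∈ U}) i₀ with hκ
  have : IsProbabilityMeasure ((G.reduce U).h22Law η') := isProbabilityMeasure_h22Law _ hη'
  have hFm := (G.induce (· ∈ U)).measurable_reducedPotential
  have hd' := (G.reduce U).measurable_h22Density η'
  have hres : Measurable fun β : V → ℝ => fun i : {i // i ∈ U} => β i :=
    measurable_pi_lambda _ fun i => measurable_pi_apply _
  have hj : Measurable fun β : V → ℝ => (G.coarsen U β, fun i : {i // i ∈ U} => β i) :=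
    G.measurable_coarsen.prodMk hres
  refine Measure.ext_of_lintegral _ fun f hf => ?_
  have hK : Measurable fun β' : ReducedVertex U → ℝ => ∫⁻ b, f (β', b) ∂(κ (β' none)) :=
    hf.lintegral_kernel_prod_right' (κ := κ.comap
      (fun β' : ReducedVertex U → ℝ => β' none) (measurable_pi_apply none))
  have hfj : Measurable fun β : V → ℝ => f (G.coarsen U β, fun i : {i // i ∈ U} => β i) :=
    hf.comp hj
  rw [lintegral_map hf hj, Measure.lintegral_compProd hf, G.lintegral_h22Law _ hfj]
  simp only [Kernel.comap_apply]
  rw [lintegral_h22Law _ _ hK]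
  refine (lintegral_gluePotential U
    ((G.measurable_h22Density _).ennreal_ofReal.mul hfj)).trans ?_
  refine Eq.trans ?_ (lintegral_reducedPoint U (hd'.ennreal_ofReal.mul hK)).symm
  refine lintegral_congr fun o => ?_
  have hrp : Measurable fun t => reducedPoint U t o :=
    (measurable_reducedPoint U).comp (measurable_id.prodMk measurable_const)
  have hg : Measurable fun t => scalarDensity (2 * t) θ :=
    measurable_scalarDensity.comp ((measurable_id.const_mul 2).prodMk measurable_const)
  have hq : Measurable fun t => ENNReal.ofReal
      ((G.reduce U).h22Density η' (reducedPoint U t o) / scalarDensity (2 * t) θ) :=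
    ((hd'.comp hrp).div hg).ennreal_ofReal
  have hfo : Measurable fun p : ℝ × ({i // i ∈ U} → ℝ) => f (reducedPoint U p.1 o, p.2) :=
    hf.comp ((hrp.comp measurable_fst).prodMk measurable_snd)
  have hh : Measurable fun p : ℝ × ({i // i ∈ U} → ℝ) => ENNReal.ofReal
      ((G.reduce U).h22Density η' (reducedPoint U p.1 o) / scalarDensity (2 * p.1) θ) *
        f (reducedPoint U p.1 o, p.2) := (hq.comp measurable_fst).mul hfo
  -- For fixed `o` the second density factor depends on `b` only through the reduced potential, so
  -- the disintegration on `U` applies; its weight `scalarDensity` then cancels the denominator in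
  -- `hh`.
  have hdis := (G.induce (· ∈ U)).lintegral_h22Law_eq_lintegral_levelKernel θ i₀ hh
  have hFi : Measurable fun b => ((G.induce (· ∈ U)).reducedPotential b, b) :=
    hFm.prodMk measurable_id
  have hlhs := (G.induce (· ∈ U)).lintegral_h22Law
    (fun _ => θ / Fintype.card {i // i ∈ U}) (hh.comp hFi)
  simp only [Pi.mul_apply]
  calc ∫⁻ b, ENNReal.ofReal (G.h22Density (splitBoundary U η') (gluePotential U b o)) *
        f (G.coarsen U (gluePotential U b o), fun i => gluePotential U b o i)
      = _ := by
        refine lintegral_congr fun b => ?_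
        rw [hU.h22Density_gluePotential ⟨i₀, i₀.2⟩, coarsen_gluePotential, gluePotential_mem,
          ENNReal.ofReal_mul (h22Density_nonneg _ _ _), mul_assoc]
        rfl
    _ = _ := hlhs.symm.trans hdis
    _ = ∫⁻ t in Ioi (0 : ℝ), ENNReal.ofReal ((G.reduce U).h22Density η' (reducedPoint U t o)) *
          ∫⁻ b, f (reducedPoint U t o, b) ∂(κ t) := by
        refine setLIntegral_congr_fun measurableSet_Ioi fun t ht => ?_
        have hgt := scalarDensity_pos θ (mul_pos two_pos ht)
        simp only
        rw [lintegral_const_mul' _ _ ENNReal.ofReal_ne_top, ← mul_assoc,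
          ← ENNReal.ofReal_mul hgt.le, mul_div_cancel₀ _ hgt.ne']
    _ = _ := by
        refine setLIntegral_eq_of_support_subset fun t ht => ?_
        by_contra hn
        refine ht ?_
        simp only
        rw [h22Density_of_not_posDef, ENNReal.ofReal_zero, zero_mul]
        -- The reduced density lives on `t > 0`, since a positive definite operator has positive
        -- diagonal.
        exact fun h => hn ((G.reduce U).pos_of_posDef h none)

end CoarseGraining

end WeightedGraph

theorem mainTheorem5 {V : Type*} [Fintype V] [DecidableEq V]
    (G : WeightedGraph V) (U : Finset V) (hU : G.Indistinguishable U)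
    (η' : ReducedVertex U → ℝ) (hη' : ∀ k, 0 ≤ η' k) (i₀ : {i // i ∈ U}) :
    -- the laws of the models on the reduced graph, on the original graph, and on the graph
    -- induced on `U` with the boundary condition that `U` feels
    IsProbabilityMeasure ((G.reduce U).h22Law η') ∧
    IsProbabilityMeasure (G.h22Law (splitBoundary U η')) ∧
    IsProbabilityMeasure
      ((G.induce (· ∈ U)).h22Law (G.innerBoundary U (splitBoundary U η'))) ∧
    (∀ᵐ β' ∂((G.reduce U).h22Law η'), 0 < β' none) ∧
    ∃ κ : Kernel ℝ ({i // i ∈ U} → ℝ), ∃ _ : IsMarkovKernel κ,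
      -- `κ t` has the explicit density on the level set `t`, and is concentrated there
      (∀ t : ℝ, 0 < t →
        κ t = (G.induce (· ∈ U)).levelLaw (G.innerBoundary U (splitBoundary U η')) i₀ t ∧
        ∀ᵐ b ∂(κ t), ((G.induce (· ∈ U)).schrodinger b).PosDef ∧
          (G.induce (· ∈ U)).reducedPotential b = t) ∧
      -- `κ` is the multivariate inverse Gaussian law on `U` conditioned on the reduced potential
      ((G.induce (· ∈ U)).h22Law (G.innerBoundary U (splitBoundary U η'))).map
          (fun b => ((G.induce (· ∈ U)).reducedPotential b, b))
        = (((G.induce (· ∈ U)).h22Law (G.innerBoundary U (splitBoundary U η'))).map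
            (G.induce (· ∈ U)).reducedPotential) ⊗ₘ κ ∧
      -- sampling `(β i)_{i ∈ U}` from `κ (β' u)` reconstructs the model on the original graph
      (((G.reduce U).h22Law η') ⊗ₘ
          κ.comap (fun β' : ReducedVertex U → ℝ => β' none) (measurable_pi_apply none)).map
          (fun p => refine U p.1 p.2)
        = G.h22Law (splitBoundary U η') ∧
      -- in the model on the original graph, the coarse-grained potential has the law of the
      -- model on the reduced graph, and, given it, `(β i)_{i ∈ U}` has the law `κ (β' u)`
      (G.h22Law (splitBoundary U η')).map
          (fun β => (G.coarsen U β, fun i : {i // i ∈ U} => β i))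
        = ((G.reduce U).h22Law η') ⊗ₘ
          κ.comap (fun β' : ReducedVertex U → ℝ => β' none) (measurable_pi_apply none) := by
  have hη : ∀ i, 0 ≤ splitBoundary U η' i := by
    intro i
    unfold splitBoundary
    split_ifs
    · exact div_nonneg (hη' _) (Nat.cast_nonneg _)
    · exact hη' _
  have hθ := G.reducedBoundary_nonneg U hη'
  have hjoint := hU.h22Law_map_coarsen hη' i₀
  have hres : Measurable fun β : V → ℝ => fun i : {i // i ∈ U} => β i :=
    measurable_pi_lambda _ fun i => measurable_pi_apply _
  -- The boundary on `U` becomes the constant one, for which the kernel is Markov.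
  rw [hU.innerBoundary_splitBoundary]
  refine ⟨WeightedGraph.isProbabilityMeasure_h22Law _ hη',
    WeightedGraph.isProbabilityMeasure_h22Law _ hη,
    WeightedGraph.isProbabilityMeasure_h22Law _ fun _ => div_nonneg hθ (Nat.cast_nonneg _), ?_,
    (G.induce (· ∈ U)).levelKernel
      (fun _ => G.reducedBoundary U η' / Fintype.card {i // i ∈ U}) i₀, inferInstance,
    fun t ht => ⟨WeightedGraph.levelKernel_of_pos _ _ _ ht,
      WeightedGraph.ae_levelKernel _ _ _ ht⟩,
    WeightedGraph.h22Law_map_eq_compProd_levelKernel _ hθ i₀, ?_, hjoint⟩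
  · filter_upwards [(G.reduce U).ae_posDef_h22Law η'] with β' h
    exact (G.reduce U).pos_of_posDef h none
  -- Fine-graining follows from the joint law, as refining the coarsened potential by its own values
  -- on `U` restores it.
  · rw [← hjoint, Measure.map_map WeightedGraph.measurable_refine
      (G.measurable_coarsen.prodMk hres)]
    have hid : (fun p : (ReducedVertex U → ℝ) × ({i // i ∈ U} → ℝ) => refine U p.1 p.2) ∘
        (fun β => (G.coarsen U β, fun i : {i // i ∈ U} => β i)) = id :=
      funext fun β => WeightedGraph.refine_coarsen U G β
    rw [hid, Measure.map_id]
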